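/- Let $M_1,M_2,N_1,N_2$ be finite-dimensional smooth manifolds (without boundary) with Riemannian metrics $g_{M_i},g_{N_i}$, let $f:M_1\to(0,\infty)$ and $\rho:N_1\to(0,\infty)$ be smooth, and let $M=M_1\times_f M_2$ and $N=N_1\times_\rho N_2$ be the warped products, so that $g_M=g_{M_1}+f^2g_{M_2}$. Let $\phi=\phi_1\times\phi_2:M\to N$, where each $\phi_i:M_i\to N_i$ is a Riemannian map, that is, a smooth map of positive rank whose differential at each point $p$ is an isometry from $(\ker\phi_{i*p})^\perp$ onto its image. Let $\mathcal V_i,\mathcal H_i$ be the orthogonal projections of $TM_i$ onto $\ker\phi_{i*}$ and $(\ker\phi_{i*})^\perp$, let $\mathcal V,\mathcal H$ be those of $TM$ onto $\ker\phi_*$ and $(\ker\phi_*)^\perp$, let $\nabla^{M_i},\nabla^M$ be the Levi-Civita connections, let $\hat\nabla^i=\mathcal V_i\nabla^{M_i}$, and let $$T_i(X,Y)=\mathcal H_i\nabla^{M_i}_{\mathcal V_iX}\mathcal V_iY+\mathcal V_i\nabla^{M_i}_{\mathcal V_iX}\mathcal H_iY,\qquad A_i(X,Y)=\mathcal H_i\nabla^{M_i}_{\mathcal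 H_iX}\mathcal V_iY+\mathcal V_i\nabla^{M_i}_{\mathcal H_iX}\mathcal H_iY$$ be O'Neill's tensors. Tangent vectors of $M_i$ are identified with their lifts to $M$, and $\nabla^M\ln f$ is the gradient on $M$ of $\ln f$, where $f$ is regarded as a function on $M$. Let $\gamma=(\gamma_1,\gamma_2):J\to M$ be a smooth curve on an open interval with $\dot\gamma\ne0$ everywhere, and put $U_i=\mathcal V_i\dot\gamma_i$, $Y_i=\mathcal H_i\dot\gamma_i$. Here $\gamma$ is called a geodesic if $\nabla^M_{\dot\gamma}\dot\gamma=0$ on $J$. All equations below are required at every time $t\in J$; derivatives of the fields $U_i,Y_i$ in the direction of $\dot\gamma_i$ are covariant derivatives along $\gamma_i$. (i) If $\dot\gamma$ is vertical ($\dot\gamma\in\ker\phi_*$), then $\gamma$ is a geodesic if and only if $$\hat\nabla^1_{U_1}U_1+2\tfrac{U_1(f)}fU_2+\hat\nabla^2_{U_2}U_2-g_M(U_2,U_2)\,\mathcal V\nabla^M\ln f=0$$ and $$T_1(U_1,U_1)+T_2(U_2,U_2)-g_M(U_2,U_2)\,\mathcal H\nabla^M\ln f=0.$$ (ii) If $\dot\gamma$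 is horizontal ($\dot\gamma\in(\ker\phi_*)^\perp$), then $\gamma$ is a geodesic if and only if $$A_1(Y_1,Y_1)+A_2(Y_2,Y_2)-g_M(Y_2,Y_2)\,\mathcal V\nabla^M\ln f=0$$ and $$\mathcal H_1\nabla^{M_1}_{Y_1}Y_1+2\tfrac{Y_1(f)}fY_2+\mathcal H_2\nabla^{M_2}_{Y_2}Y_2-g_M(Y_2,Y_2)\,\mathcal H\nabla^M\ln f=0.$$ (iii) For arbitrary $\dot\gamma$, $\gamma$ is a geodesic if and only if $$\begin{aligned}&\hat\nabla^1_{U_1}U_1+T_1(U_1,Y_1)+\mathcal V_1\nabla^{M_1}_{Y_1}U_1+A_1(Y_1,Y_1)+2\tfrac{U_1(f)}fU_2+2\tfrac{Y_1(f)}fU_2\\&-g_M(U_2,U_2)\,\mathcal V\nabla^M\ln f-g_M(Y_2,Y_2)\,\mathcal V\nabla^M\ln f\\&+\hat\nabla^2_{U_2}U_2+T_2(U_2,Y_2)+A_2(Y_2,Y_2)+\mathcal V_2\nabla^{M_2}_{Y_2}U_2=0\end{aligned}$$ and $$\begin{aligned}&T_1(U_1,U_1)+T_2(U_2,U_2)+\mathcal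 H_1\nabla^{M_1}_{U_1}Y_1+\mathcal H_2\nabla^{M_2}_{U_2}Y_2+A_1(Y_1,U_1)+A_2(Y_2,U_2)\\&+\mathcal H_1\nabla^{M_1}_{Y_1}Y_1+\mathcal H_2\nabla^{M_2}_{Y_2}Y_2+2\tfrac{U_1(f)}fY_2+2\tfrac{Y_1(f)}fY_2\\&-g_M(U_2,U_2)\,\mathcal H\nabla^M\ln f-g_M(Y_2,Y_2)\,\mathcal H\nabla^M\ln f=0.\end{aligned}$$ In (iii) the sums $\hat\nabla^i_{U_i}U_i+\mathcal V_i\nabla^{M_i}_{Y_i}U_i$ and $\mathcal H_i\nabla^{M_i}_{U_i}Y_i+\mathcal H_i\nabla^{M_i}_{Y_i}Y_i$ mean $\mathcal V_i\nabla^{M_i}_{\dot\gamma_i}U_i$ and $\mathcal H_i\nabla^{M_i}_{\dot\gamma_i}Y_i$, the covariant derivatives being taken along $\gamma_i$. Whenever for every $t\in J$ there are chosen vector fields on $M_i$, smooth at $\gamma_i(t)$, that agree at $\gamma_i(s)$ with $U_i(s)$, respectively $Y_i(s)$, for all $s$ near $t$, the equivalence also holds with the separate terms computed from these extensions. -/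

import Mathlib

open Manifold Topology
open scoped ContDiff

namespace WarpedGeodesic

noncomputable section

section Generic

variable {E : Type*} [NormedAddCommGroup E] [NormedSpace ℝ E]
  {H : Type*} [TopologicalSpace H] {I : ModelWithCorners ℝ E H}
  {M : Type*} [TopologicalSpace M] [ChartedSpace H M] [IsManifold I ∞ M]

variable (I M) in
/-- Smooth Riemannian metrics on the manifold `M`. -/
abbrev Metric : Type _ :=
  Bundle.ContMDiffRiemannianMetric I ∞ E (fun x : M => TangentSpace I x)

/-- The inner product on the tangent space at `x`, as a bilinear form. -/
def Metric.form (g : Metric I M) (x : M) : LinearMap.BilinForm ℝ (TangentSpace I x) :=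
  LinearMap.mk₂ ℝ (fun v w => g.inner x v w) (by simp) (by simp) (by simp) (by simp)

theorem Metric.form_apply (g : Metric I M) (x : M) (v w : TangentSpace I x) :
    g.form x v w = g.inner x v w := rfl

theorem Metric.form_isRefl (g : Metric I M) (x : M) : (g.form x).IsRefl := by
  intro v w h
  rw [Metric.form_apply] at h ⊢
  rw [g.symm, h]

theorem Metric.form_injective (g : Metric I M) (x : M) : Function.Injective (g.form x) := by
  rw [injective_iff_map_eq_zero]
  intro v hv
  by_contra hne
  have h := g.pos x v hne
  rw [← Metric.form_apply, hv] at h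
  simp at h

instance finiteDimensional_tangentSpace [FiniteDimensional ℝ E] (x : M) :
    FiniteDimensional ℝ (TangentSpace I x) :=
  inferInstanceAs (FiniteDimensional ℝ E)

/-- The musical isomorphism `v ↦ g(v, ·)` at the point `x`. -/
def Metric.flat [FiniteDimensional ℝ E] (g : Metric I M) (x : M) :
    TangentSpace I x ≃ₗ[ℝ] Module.Dual ℝ (TangentSpace I x) :=
  LinearMap.linearEquivOfInjective (g.form x) (g.form_injective x) Subspace.dual_finrank_eq.symm

/-- The tangent vector `v` at `x` with `g(v, w) = ℓ w` for all `w`. -/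
def Metric.sharp [FiniteDimensional ℝ E] (g : Metric I M) (x : M)
    (ℓ : Module.Dual ℝ (TangentSpace I x)) : TangentSpace I x :=
  (g.flat x).symm ℓ

theorem Metric.inner_sharp [FiniteDimensional ℝ E] (g : Metric I M) (x : M)
    (ℓ : Module.Dual ℝ (TangentSpace I x)) (w : TangentSpace I x) :
    g.inner x (g.sharp x ℓ) w = ℓ w :=
  LinearMap.congr_fun ((g.flat x).apply_symm_apply ℓ) w

/-- The gradient of a function. -/
def Metric.grad [FiniteDimensional ℝ E] (g : Metric I M) (u : M → ℝ) (x : M) :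
    TangentSpace I x :=
  g.sharp x (mvfderiv I u x : TangentSpace I x →L[ℝ] ℝ)

/-! ### The Levi-Civita connection -/

variable (I) in
/-- The value at `y` of the vector field that has constant components `a` in the preferred chart
around `x` (that is, `∑ aⁱ ∂ᵢ`, where the `∂ᵢ` are the coordinate fields of that chart).
It is zero when `y` is outside of the domain of that chart. -/
def coordField (x y : M) : E →L[ℝ] TangentSpace I y :=
  (trivializationAt E (TangentSpace I) x).symmL ℝ y

theorem coordField_eq_symm {x y : M} (hy : y ∈ (chartAt H x).source) (a : E) :
    (trivializationAt E (TangentSpace I) x).symm y a = coordField I x y a :=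
  (Bundle.Trivialization.symmL_apply (R := ℝ) (trivializationAt E (TangentSpace I) x) hy a).symm

variable (I) in
/-- The components of a tangent vector at `y` in the preferred chart around `x`. -/
def coordComp (x y : M) : TangentSpace I y →L[ℝ] E :=
  (trivializationAt E (TangentSpace I) x).continuousLinearMapAt ℝ y

/-- The metric in the preferred chart around `x`:
`g.coord x y a b = ∑ gᵢⱼ(y) aⁱ bʲ`. -/
def Metric.coord (g : Metric I M) (x y : M) : E →L[ℝ] E →L[ℝ] ℝ :=
  (coordField I x y).precomp ℝ ∘L g.inner y ∘L coordField I x y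

theorem Metric.coord_apply (g : Metric I M) (x y : M) (a b : E) :
    g.coord x y a b = g.inner y (coordField I x y a) (coordField I x y b) := rfl

/-- The derivative at `x` of the metric coefficients in the preferred chart around `x`, so that
`g.coordDeriv x v a b = ∑ v(gᵢⱼ) aⁱ bʲ`. -/
def Metric.coordDeriv (g : Metric I M) (x : M) : TangentSpace I x →L[ℝ] E →L[ℝ] E →L[ℝ] ℝ :=
  mvfderiv I (g.coord x) x

/-- The linear form
`w ↦ ½ (∂ᵢ gⱼₖ + ∂ⱼ gᵢₖ - ∂ₖ gᵢⱼ) uⁱ vʲ wᵏ` at `x`, computed in the preferred chart around `x`. -/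
def Metric.christoffelForm (g : Metric I M) (x : M) (u v : TangentSpace I x) :
    Module.Dual ℝ (TangentSpace I x) where
  toFun w := (1 / 2 : ℝ) *
    (g.coordDeriv x u (coordComp I x x v) (coordComp I x x w)
      + g.coordDeriv x v (coordComp I x x u) (coordComp I x x w)
      - g.coordDeriv x w (coordComp I x x u) (coordComp I x x v))
  map_add' w w' := by
    rw [map_add, map_add, map_add, map_add, add_apply,
      add_apply]
    ring
  map_smul' c w := by
    rw [map_smul, map_smul, map_smul, map_smul, smul_apply,
      smul_apply]
    simp only [smul_eq_mul, RingHom.id_apply]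
    ring

/-- The Christoffel term `Γ(u, v) = ∑ Γᵏᵢⱼ uⁱ vʲ ∂ₖ` at `x`, in the preferred chart around `x`. -/
def Metric.christoffel [FiniteDimensional ℝ E] (g : Metric I M) (x : M)
    (u v : TangentSpace I x) : TangentSpace I x :=
  g.sharp x (g.christoffelForm x u v)

/-- The Levi-Civita covariant derivative `∇_v X` at `x` of a vector field `X` in the direction of
`v`, computed in the preferred chart around `x`: `∇_v X = ∑ (v(Xᵏ) + Γᵏᵢⱼ vⁱ Xʲ) ∂ₖ`. -/
def Metric.nabla [FiniteDimensional ℝ E] (g : Metric I M) (X : ∀ y : M, TangentSpace I y) (x : M)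
    (v : TangentSpace I x) : TangentSpace I x :=
  coordField I x x (mvfderiv I (fun y => coordComp I x y (X y)) x v) + g.christoffel x v (X x)

variable (I) in
/-- The velocity of a curve. -/
def velocity (γ : ℝ → M) (t : ℝ) : TangentSpace I (γ t) :=
  mfderiv 𝓘(ℝ, ℝ) I γ t (1 : ℝ)

/-- The Levi-Civita covariant derivative `∇_γ̇ W` at time `t` of a vector field `W` along the
curve `γ`, computed in the preferred chart around `γ t`:
`∇_γ̇ W = ∑ ((Wᵏ)' + Γᵏᵢⱼ γ̇ⁱ Wʲ) ∂ₖ`. -/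
def Metric.covDerivAlong [FiniteDimensional ℝ E] (g : Metric I M) (γ : ℝ → M)
    (W : ∀ s : ℝ, TangentSpace I (γ s)) (t : ℝ) : TangentSpace I (γ t) :=
  coordField I (γ t) (γ t) (deriv (fun s => coordComp I (γ t) (γ s) (W s)) t)
    + g.christoffel (γ t) (velocity I γ t) (W t)

variable (I) in
/-- `γ` is a smooth curve on `J` whose velocity does not vanish. -/
def IsRegularCurveOn (γ : ℝ → M) (J : Set ℝ) : Prop :=
  ContMDiffOn 𝓘(ℝ, ℝ) I ∞ γ J ∧ ∀ t ∈ J, velocity I γ t ≠ 0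

/-- `∇_γ̇ γ̇ = 0` on `J`. -/
def IsGeodesicOn [FiniteDimensional ℝ E] (g : Metric I M) (γ : ℝ → M) (J : Set ℝ) : Prop :=
  ∀ t ∈ J, g.covDerivAlong γ (velocity I γ) t = 0

variable (I) in
/-- `X` is a vector field on `M`, smooth at `γ t`, which extends the vector field `W` along `γ` for
times close to `t`, that is, `X (γ s) = W s` for all `s` close to `t`. -/
def IsLocalExtensionAt (γ : ℝ → M) (W : ∀ s : ℝ, TangentSpace I (γ s)) (t : ℝ)
    (X : ∀ y : M, TangentSpace I y) : Prop :=
  ContMDiffAt I (I.prod 𝓘(ℝ, E)) ∞ (fun y => Bundle.TotalSpace.mk' E y (X y)) (γ t) ∧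
    ∀ᶠ s in 𝓝 t, X (γ s) = W s

/-! ### Vertical and horizontal distributions, O'Neill tensors -/

variable {E' : Type*} [NormedAddCommGroup E'] [NormedSpace ℝ E']
  {H' : Type*} [TopologicalSpace H'] {I' : ModelWithCorners ℝ E' H'}
  {N : Type*} [TopologicalSpace N] [ChartedSpace H' N] [IsManifold I' ∞ N]

set_option linter.unusedSectionVars false

variable (I I') in
/-- The vertical space `ker φ_*` at `x`. -/
def vertical (φ : M → N) (x : M) : Submodule ℝ (TangentSpace I x) :=
  LinearMap.ker (mfderiv I I' φ x : TangentSpace I x →ₗ[ℝ] TangentSpace I' (φ x))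

variable (I') in
/-- The horizontal space `(ker φ_*)^⊥` at `x`. -/
def horizontal (g : Metric I M) (φ : M → N) (x : M) : Submodule ℝ (TangentSpace I x) :=
  (g.form x).orthogonal (vertical I I' φ x)

theorem isCompl_vertical_horizontal [FiniteDimensional ℝ E] (g : Metric I M) (φ : M → N) (x : M) :
    IsCompl (vertical I I' φ x) (horizontal I' g φ x) := by
  unfold horizontal
  rw [LinearMap.BilinForm.isCompl_orthogonal_iff_disjoint (g.form_isRefl x),
    Submodule.disjoint_def]
  intro v hv hv'
  by_contra hne
  exact (g.pos x v hne).ne' ((LinearMap.BilinForm.mem_orthogonal_iff.1 hv') v hv)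

variable (I') in
/-- The projection `𝒱` onto the vertical space along the horizontal space. -/
def vertProj [FiniteDimensional ℝ E] (g : Metric I M) (φ : M → N) (x : M) :
    TangentSpace I x →ₗ[ℝ] TangentSpace I x :=
  (vertical I I' φ x).projection (horizontal I' g φ x) (isCompl_vertical_horizontal g φ x)

variable (I') in
/-- The projection `ℋ` onto the horizontal space along the vertical space. -/
def horProj [FiniteDimensional ℝ E] (g : Metric I M) (φ : M → N) (x : M) :
    TangentSpace I x →ₗ[ℝ] TangentSpace I x :=
  (horizontal I' g φ x).projection (vertical I I' φ x) (isCompl_vertical_horizontal g φ x).symm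

variable (I') in
/-- O'Neill's `T_X Y = ℋ ∇_{𝒱 X} 𝒱 Y + 𝒱 ∇_{𝒱 X} ℋ Y`, for vector fields `X`, `Y`. -/
def oneillTField [FiniteDimensional ℝ E] (g : Metric I M) (φ : M → N)
    (X Y : ∀ y : M, TangentSpace I y) (x : M) : TangentSpace I x :=
  horProj I' g φ x (g.nabla (fun y => vertProj I' g φ y (Y y)) x (vertProj I' g φ x (X x)))
    + vertProj I' g φ x (g.nabla (fun y => horProj I' g φ y (Y y)) x (vertProj I' g φ x (X x)))

variable (I') in
/-- O'Neill's `A_X Y = ℋ ∇_{ℋ X} 𝒱 Y + 𝒱 ∇_{ℋ X} ℋ Y`, for vector fields `X`, `Y`. -/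
def oneillAField [FiniteDimensional ℝ E] (g : Metric I M) (φ : M → N)
    (X Y : ∀ y : M, TangentSpace I y) (x : M) : TangentSpace I x :=
  horProj I' g φ x (g.nabla (fun y => vertProj I' g φ y (Y y)) x (horProj I' g φ x (X x)))
    + vertProj I' g φ x (g.nabla (fun y => horProj I' g φ y (Y y)) x (horProj I' g φ x (X x)))

variable (I') in
/-- The tensor `T` evaluated on two tangent vectors at `x`. As `T_X Y` at `x` is tensorial in `X`
and `Y`, the vectors may be extended in any way; here the extension is the one that has
constant components in the preferred chart around `x`. -/
def oneillT [FiniteDimensional ℝ E] (g : Metric I M) (φ : M → N) (x : M)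
    (u v : TangentSpace I x) : TangentSpace I x :=
  oneillTField I' g φ (fun y => coordField I x y (coordComp I x x u))
    (fun y => coordField I x y (coordComp I x x v)) x

variable (I') in
/-- The tensor `A` evaluated on two tangent vectors at `x`, see `oneillT`. -/
def oneillA [FiniteDimensional ℝ E] (g : Metric I M) (φ : M → N) (x : M)
    (u v : TangentSpace I x) : TangentSpace I x :=
  oneillAField I' g φ (fun y => coordField I x y (coordComp I x x u))
    (fun y => coordField I x y (coordComp I x x v)) x

/-- A Riemannian map of positive rank: a smooth map whose differential is, at each point, an
isometry from the horizontal space onto the range of the differential. -/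
structure IsRiemannianMap (g : Metric I M) (h : Metric I' N) (φ : M → N) : Prop where
  contMDiff : ContMDiff I I' ∞ φ
  rank_pos : ∀ x, 0 < Module.finrank ℝ
    (LinearMap.range (mfderiv I I' φ x : TangentSpace I x →ₗ[ℝ] TangentSpace I' (φ x)))
  isometry : ∀ x, ∀ X ∈ horizontal I' g φ x, ∀ Y ∈ horizontal I' g φ x,
    h.inner (φ x) (mfderiv I I' φ x X) (mfderiv I I' φ x Y) = g.inner x X Y

end Generic

section Product

variable {E₁ : Type*} [NormedAddCommGroup E₁] [NormedSpace ℝ E₁] [FiniteDimensional ℝ E₁]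
  {H₁ : Type*} [TopologicalSpace H₁] {I₁ : ModelWithCorners ℝ E₁ H₁}
  {M₁ : Type*} [TopologicalSpace M₁] [ChartedSpace H₁ M₁] [IsManifold I₁ ∞ M₁]
  {E₂ : Type*} [NormedAddCommGroup E₂] [NormedSpace ℝ E₂] [FiniteDimensional ℝ E₂]
  {H₂ : Type*} [TopologicalSpace H₂] {I₂ : ModelWithCorners ℝ E₂ H₂}
  {M₂ : Type*} [TopologicalSpace M₂] [ChartedSpace H₂ M₂] [IsManifold I₂ ∞ M₂]

variable (I₁ I₂) in
/-- `π₁_*`, the differential of the projection `M₁ × M₂ → M₁`. -/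
def dfst (x : M₁ × M₂) : TangentSpace (I₁.prod I₂) x →L[ℝ] TangentSpace I₁ x.1 :=
  mfderiv (I₁.prod I₂) I₁ Prod.fst x

variable (I₁ I₂) in
/-- `π₂_*`, the differential of the projection `M₁ × M₂ → M₂`. -/
def dsnd (x : M₁ × M₂) : TangentSpace (I₁.prod I₂) x →L[ℝ] TangentSpace I₂ x.2 :=
  mfderiv (I₁.prod I₂) I₂ Prod.snd x

/-- The bilinear form `g₁(π₁_* v, π₁_* w) + f² g₂(π₂_* v, π₂_* w)`. -/
def warpedInner (g₁ : Metric I₁ M₁) (g₂ : Metric I₂ M₂) (f : M₁ → ℝ) (x : M₁ × M₂) :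
    TangentSpace (I₁.prod I₂) x →L[ℝ] TangentSpace (I₁.prod I₂) x →L[ℝ] ℝ :=
  (dfst I₁ I₂ x).precomp ℝ ∘L g₁.inner x.1 ∘L dfst I₁ I₂ x
    + (f x.1 ^ 2) • ((dsnd I₁ I₂ x).precomp ℝ ∘L g₂.inner x.2 ∘L dsnd I₁ I₂ x)

theorem warpedInner_apply (g₁ : Metric I₁ M₁) (g₂ : Metric I₂ M₂) (f : M₁ → ℝ) (x : M₁ × M₂)
    (v w : TangentSpace (I₁.prod I₂) x) :
    warpedInner g₁ g₂ f x v w = g₁.inner x.1 (dfst I₁ I₂ x v) (dfst I₁ I₂ x w)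
      + f x.1 ^ 2 * g₂.inner x.2 (dsnd I₁ I₂ x v) (dsnd I₁ I₂ x w) := rfl

theorem warpedInner_pos (g₁ : Metric I₁ M₁) (g₂ : Metric I₂ M₂) (f : M₁ → ℝ)
    (hf : ∀ x, 0 < f x) (x : M₁ × M₂)
    (v : TangentSpace (I₁.prod I₂) x) (hv : v ≠ 0) : 0 < warpedInner g₁ g₂ f x v v := by
  rw [warpedInner_apply]
  have h1 : 0 ≤ g₁.inner x.1 (dfst I₁ I₂ x v) (dfst I₁ I₂ x v) := by
    by_cases h : dfst I₁ I₂ x v = 0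
    · simp [h]
    · exact (g₁.pos _ _ h).le
  have h2 : 0 ≤ g₂.inner x.2 (dsnd I₁ I₂ x v) (dsnd I₁ I₂ x v) := by
    by_cases h : dsnd I₁ I₂ x v = 0
    · simp [h]
    · exact (g₂.pos _ _ h).le
  by_cases h : dfst I₁ I₂ x v = 0
  · have h' : dsnd I₁ I₂ x v ≠ 0 := by
      intro h'
      apply hv
      rw [dfst, mfderiv_fst] at h
      rw [dsnd, mfderiv_snd] at h'
      exact Prod.ext h h'
    have := g₂.pos _ _ h'
    have := hf x.1
    positivity
  · have := g₁.pos _ _ h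
    positivity

theorem isVonNBounded_of_posDef {V : Type*} [NormedAddCommGroup V] [NormedSpace ℝ V]
    [FiniteDimensional ℝ V] (B : V →L[ℝ] V →L[ℝ] ℝ) (hB : ∀ v, v ≠ 0 → 0 < B v v) :
    Bornology.IsVonNBounded ℝ {v : V | B v v < 1} := by
  rw [NormedSpace.isVonNBounded_iff]
  by_cases hne : (Metric.sphere (0 : V) 1).Nonempty
  · obtain ⟨v₀, hv₀, hmin⟩ := (isCompact_sphere (0 : V) 1).exists_isMinOn hne
      (f := fun v => B v v) (by fun_prop)
    have hv₀' : v₀ ≠ 0 := by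
      rintro rfl
      simp at hv₀
    have hc := hB v₀ hv₀'
    rw [isBounded_iff_forall_norm_le]
    refine ⟨1 / √(B v₀ v₀), fun v hv => ?_⟩
    by_cases h0 : v = 0
    · simp only [h0, norm_zero]; positivity
    have hn : 0 < ‖v‖ := norm_pos_iff.2 h0
    have h1 := hmin (show (‖v‖⁻¹ • v) ∈ Metric.sphere (0 : V) 1 by
      simp [norm_smul, hn.ne'])
    simp only [map_smul, smul_apply, smul_eq_mul, Set.mem_ofPred_eq] at h1 hv
    have h2 : B v₀ v₀ * ‖v‖ ^ 2 ≤ 1 := by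
      have : B v₀ v₀ * ‖v‖ ^ 2 ≤ (‖v‖⁻¹ * (‖v‖⁻¹ * B v v)) * ‖v‖ ^ 2 := by gcongr
      have e : (‖v‖⁻¹ * (‖v‖⁻¹ * B v v)) * ‖v‖ ^ 2 = B v v := by field_simp
      linarith
    rw [le_div_iff₀ (by positivity)]
    apply le_of_sq_le_sq _ zero_le_one
    rw [mul_pow, Real.sq_sqrt hc.le]
    linarith
  · have : ∀ v : V, v = 0 := by
      intro v
      by_contra h0
      exact hne ⟨‖v‖⁻¹ • v, by simp [norm_smul, norm_ne_zero_iff.2 h0]⟩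
    have : Subsingleton V := ⟨fun a b => by rw [this a, this b]⟩
    exact (Set.toFinite _).isBounded

theorem coordField_prod (x y : M₁ × M₂) (hy : y ∈ (chartAt (ModelProd H₁ H₂) x).source)
    (a : E₁ × E₂) :
    coordField (I₁.prod I₂) x y a = (coordField I₁ x.1 y.1 a.1, coordField I₂ x.2 y.2 a.2) := by
  have hy' : y.1 ∈ (chartAt H₁ x.1).source ∧ y.2 ∈ (chartAt H₂ x.2).source := by
    simpa using hy
  have hs1 : y.1 ∈ (extChartAt I₁ x.1).source := by simpa using hy'.1
  have hs2 : y.2 ∈ (extChartAt I₂ x.2).source := by simpa using hy'.2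
  have hs : y ∈ (extChartAt (I₁.prod I₂) x).source := by simpa using hy'
  unfold coordField
  rw [TangentBundle.symmL_trivializationAt_eq_core hy, TangentBundle.symmL_trivializationAt_eq_core hy'.1,
    TangentBundle.symmL_trivializationAt_eq_core hy'.2]
  have h1 := hasFDerivWithinAt_tangentCoordChange (I := I₁) (x := x.1) (y := y.1) (z := y.1)
    ⟨hs1, by simp⟩
  have h2 := hasFDerivWithinAt_tangentCoordChange (I := I₂) (x := x.2) (y := y.2) (z := y.2)
    ⟨hs2, by simp⟩
  have h := hasFDerivWithinAt_tangentCoordChange (I := I₁.prod I₂) (x := x) (y := y) (z := y)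
    ⟨hs, by simp⟩
  have h12 := HasFDerivWithinAt.prodMap (s := Set.range I₁ ×ˢ Set.range I₂)
    (extChartAt I₁ x.1 y.1, extChartAt I₂ x.2 y.2)
    (h1.mono (Set.fst_image_prod_subset _ _)) (h2.mono (Set.snd_image_prod_subset _ _))
  have hu : UniqueDiffWithinAt ℝ (Set.range (I₁.prod I₂)) (extChartAt (I₁.prod I₂) x y) :=
    (I₁.prod I₂).uniqueDiffOn _ (by rw [extChartAt_prod]; exact ⟨(chartAt H₁ x.1 y.1, chartAt H₂ x.2 y.2), rfl⟩)
  have hr : Set.range (I₁.prod I₂) = Set.range I₁ ×ˢ Set.range I₂ := by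
    rw [modelWithCorners_prod_coe, Set.range_prodMap]
  have := hu.eq h (by rw [hr]; exact h12)
  exact congrArg (fun L : E₁ × E₂ →L[ℝ] E₁ × E₂ => L a) this

theorem dfst_coordField {x y : M₁ × M₂} (hy : y ∈ (chartAt (ModelProd H₁ H₂) x).source)
    (a : E₁ × E₂) :
    dfst I₁ I₂ y (coordField (I₁.prod I₂) x y a) = coordField I₁ x.1 y.1 a.1 := by
  rw [dfst, mfderiv_fst]
  exact congrArg Prod.fst (coordField_prod x y hy a)

theorem dsnd_coordField {x y : M₁ × M₂} (hy : y ∈ (chartAt (ModelProd H₁ H₂) x).source)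
    (a : E₁ × E₂) :
    dsnd I₁ I₂ y (coordField (I₁.prod I₂) x y a) = coordField I₂ x.2 y.2 a.2 := by
  rw [dsnd, mfderiv_snd]
  exact congrArg Prod.snd (coordField_prod x y hy a)

theorem contMDiff_warpedInner (g₁ : Metric I₁ M₁) (g₂ : Metric I₂ M₂) (f : M₁ → ℝ)
    (hf : ContMDiff I₁ 𝓘(ℝ, ℝ) ∞ f) :
    ContMDiff (I₁.prod I₂) ((I₁.prod I₂).prod 𝓘(ℝ, E₁ × E₂ →L[ℝ] E₁ × E₂ →L[ℝ] ℝ)) ∞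
      (fun x => Bundle.TotalSpace.mk' (E₁ × E₂ →L[ℝ] E₁ × E₂ →L[ℝ] ℝ) x
        (warpedInner g₁ g₂ f x)) := by
  intro x
  rw [contMDiffAt_hom_bundle]
  refine ⟨contMDiffAt_id, ?_⟩
  have h1 := ((contMDiffAt_hom_bundle _).1 (g₁.contMDiff x.1)).2
  have h2 := ((contMDiffAt_hom_bundle _).1 (g₂.contMDiff x.2)).2
  have k1 := h1.comp x (contMDiffAt_fst (I := I₁) (J := I₂))
  have k2 := h2.comp x (contMDiffAt_snd (I := I₁) (J := I₂))
  have kf := (hf x.1).comp x (contMDiffAt_fst (I := I₁) (J := I₂))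
  have m1 := (contMDiffAt_const (c := (ContinuousLinearMap.fst ℝ E₁ E₂).precomp ℝ)).clm_comp
    (k1.clm_comp (contMDiffAt_const (c := ContinuousLinearMap.fst ℝ E₁ E₂)))
  have m2 := (contMDiffAt_const (c := (ContinuousLinearMap.snd ℝ E₁ E₂).precomp ℝ)).clm_comp
    (k2.clm_comp (contMDiffAt_const (c := ContinuousLinearMap.snd ℝ E₁ E₂)))
  refine (m1.add ((kf.pow 2).smul m2)).congr_of_eventuallyEq ?_
  filter_upwards [(chartAt (ModelProd H₁ H₂) x).open_source.mem_nhds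
    (mem_chart_source (ModelProd H₁ H₂) x)] with y hy
  have hy' : y.1 ∈ (chartAt H₁ x.1).source ∧ y.2 ∈ (chartAt H₂ x.2).source := by
    simpa using hy
  refine ContinuousLinearMap.ext fun a => ContinuousLinearMap.ext fun b => ?_
  have e1 := inCoordinates_apply_eq₂ (ϕ := g₁.inner y.1) (x₀ := x.1) (v := a.1) (w := b.1)
    (F₃ := ℝ) (E₃ := Bundle.Trivial M₁ ℝ) hy'.1 hy'.1 (Set.mem_univ _)
  have e2 := inCoordinates_apply_eq₂ (ϕ := g₂.inner y.2) (x₀ := x.2) (v := a.2) (w := b.2)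
    (F₃ := ℝ) (E₃ := Bundle.Trivial M₂ ℝ) hy'.2 hy'.2 (Set.mem_univ _)
  refine (inCoordinates_apply_eq₂ (F₃ := ℝ) (E₃ := Bundle.Trivial (M₁ × M₂) ℝ) hy hy (Set.mem_univ _)).trans ?_
  refine Eq.trans ?_ (congrArg₂ (fun p q : ℝ => p + f y.1 ^ 2 * q) e1.symm e2.symm)
  simp only [Bundle.Trivial.fiberBundle_trivializationAt',
    Bundle.Trivial.linearMapAt_trivialization, LinearMap.id_coe, id_eq]
  rw [coordField_eq_symm hy, coordField_eq_symm hy, coordField_eq_symm hy'.1,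
    coordField_eq_symm hy'.1, coordField_eq_symm hy'.2, coordField_eq_symm hy'.2]
  rw [warpedInner_apply, dfst_coordField hy, dfst_coordField hy, dsnd_coordField hy,
    dsnd_coordField hy]

/-- The data of a warped product `M₁ ×_f M₂`: Riemannian metrics on the two factors and a positive
smooth function on the first one. -/
structure WarpedProduct (I₁ : ModelWithCorners ℝ E₁ H₁) (M₁ : Type*) [TopologicalSpace M₁]
    [ChartedSpace H₁ M₁] [IsManifold I₁ ∞ M₁] (I₂ : ModelWithCorners ℝ E₂ H₂) (M₂ : Type*)
    [TopologicalSpace M₂] [ChartedSpace H₂ M₂] [IsManifold I₂ ∞ M₂] where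
  g₁ : Metric I₁ M₁
  g₂ : Metric I₂ M₂
  f : M₁ → ℝ
  f_smooth : ContMDiff I₁ 𝓘(ℝ, ℝ) ∞ f
  f_pos : ∀ x, 0 < f x

/-- The warped product metric on `M₁ × M₂`. -/
def WarpedProduct.metric (W : WarpedProduct I₁ M₁ I₂ M₂) : Metric (I₁.prod I₂) (M₁ × M₂) where
  inner := warpedInner W.g₁ W.g₂ W.f
  symm x v w := by
    rw [warpedInner_apply, warpedInner_apply, W.g₁.symm, W.g₂.symm]
  pos := warpedInner_pos W.g₁ W.g₂ W.f W.f_pos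
  isVonNBounded x :=
    isVonNBounded_of_posDef (V := E₁ × E₂) (warpedInner W.g₁ W.g₂ W.f x)
      (warpedInner_pos W.g₁ W.g₂ W.f W.f_pos x)
  contMDiff := contMDiff_warpedInner W.g₁ W.g₂ W.f W.f_smooth

variable (I₁ I₂) in
/-- The lift of a tangent vector of `M₁` at `x.1` to a tangent vector of `M₁ × M₂` at `x`: the
image under the differential of the inclusion `y ↦ (y, x.2)`. -/
def lift₁ (x : M₁ × M₂) : TangentSpace I₁ x.1 →L[ℝ] TangentSpace (I₁.prod I₂) x :=
  mfderiv I₁ (I₁.prod I₂) (fun y : M₁ => (y, x.2)) x.1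

variable (I₁ I₂) in
/-- The lift of a tangent vector of `M₂` at `x.2` to a tangent vector of `M₁ × M₂` at `x`: the
image under the differential of the inclusion `y ↦ (x.1, y)`. -/
def lift₂ (x : M₁ × M₂) : TangentSpace I₂ x.2 →L[ℝ] TangentSpace (I₁.prod I₂) x :=
  mfderiv I₂ (I₁.prod I₂) (fun y : M₂ => (x.1, y)) x.2

/-- `∇^M ln f`, the gradient of `ln f` for the warped product metric, where `f` is regarded as a
function on `M₁ × M₂`. -/
def WarpedProduct.gradLog (W : WarpedProduct I₁ M₁ I₂ M₂) (x : M₁ × M₂) :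
    TangentSpace (I₁.prod I₂) x :=
  W.metric.grad (fun y => Real.log (W.f y.1)) x

variable {F₁ : Type*} [NormedAddCommGroup F₁] [NormedSpace ℝ F₁] [FiniteDimensional ℝ F₁]
  {K₁ : Type*} [TopologicalSpace K₁] {J₁ : ModelWithCorners ℝ F₁ K₁}
  {N₁ : Type*} [TopologicalSpace N₁] [ChartedSpace K₁ N₁] [IsManifold J₁ ∞ N₁]
  {F₂ : Type*} [NormedAddCommGroup F₂] [NormedSpace ℝ F₂] [FiniteDimensional ℝ F₂]
  {K₂ : Type*} [TopologicalSpace K₂] {J₂ : ModelWithCorners ℝ F₂ K₂}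
  {N₂ : Type*} [TopologicalSpace N₂] [ChartedSpace K₂ N₂] [IsManifold J₂ ∞ N₂]

/-- `φ = φ₁ × φ₂` is a Riemannian warped product map between the warped products `W` and `Z`. -/
structure IsRiemannianWarpedProductMap (W : WarpedProduct I₁ M₁ I₂ M₂)
    (Z : WarpedProduct J₁ N₁ J₂ N₂) (φ₁ : M₁ → N₁) (φ₂ : M₂ → N₂) (φ : M₁ × M₂ → N₁ × N₂) :
    Prop where
  fst : IsRiemannianMap W.g₁ Z.g₁ φ₁
  snd : IsRiemannianMap W.g₂ Z.g₂ φ₂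
  eq_prod : ∀ p, φ p = (φ₁ p.1, φ₂ p.2)

end Product

end

end WarpedGeodesic

/-!
Splitting `∇_γ̇ γ̇` into its vertical and horizontal parts gives the equations; `γ` is a geodesic
exactly when both parts vanish. The computation has two independent ingredients.

*The warped product.* In product charts the metric coefficients of `M₁ ×_f M₂` are those of `g₁`
plus `f²` times those of `g₂`. Differentiating them and pairing the Christoffel term with an
arbitrary vector yields
`∇_γ̇ γ̇ = ∇¹_γ̇₁ γ̇₁ + ∇²_γ̇₂ γ̇₂ + 2 (γ̇₁(f) / f) γ̇₂ - g(γ̇₂, γ̇₂) ∇ ln f`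
(`WarpedProduct.covDerivAlong_velocity`). Since the vertical and horizontal spaces of `φ₁ × φ₂` are
the products of those of `φ₁` and `φ₂`, the projections commute with lifting
(`IsRiemannianWarpedProductMap.vertProj_lift₁` and its companions).

*The factors.* On each factor `γ̇ᵢ = Uᵢ + Yᵢ`, and the Leibniz rule applied to `Uᵢ = 𝒱ᵢ γ̇ᵢ` and
`Yᵢ = ℋᵢ γ̇ᵢ` requires the projections to be differentiable in the base point. For a Riemannian map
this needs no discussion of the rank: `g(ℋ v, w) = h(φ_* v, φ_* w)`, so that `ℋ = g⁻¹ (φ^* h)` is as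
smooth as `g`, `h` and `φ_*` (`IsRiemannianMap.mdifferentiableAt_horCoord`). Differentiating
`ℋ² = ℋ` then shows that `ℋ ∇_γ̇ U` and `𝒱 ∇_γ̇ Y` depend only on the values of `U` and `Y` at the
point, and that they are
`ℋ ∇_γ̇ U = T(U, U) + A(Y, U)` and `𝒱 ∇_γ̇ Y = T(U, Y) + A(Y, Y)`
(`vertProj_covDerivAlong_velocity`, `horProj_covDerivAlong_velocity`).

Together these give the equations for arbitrary velocity. Those for vertical or horizontal velocity
are the special cases in which the `Yᵢ`, respectively the `Uᵢ`, vanish on the open set `J`, so that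
their derivatives vanish as well.
-/

namespace WarpedGeodesic

noncomputable section

/-! ### Derivatives of vector-valued functions on a manifold -/

section VectorValued

variable {E : Type*} [NormedAddCommGroup E] [NormedSpace ℝ E]
  {H : Type*} [TopologicalSpace H] {I : ModelWithCorners ℝ E H}
  {M : Type*} [TopologicalSpace M] [ChartedSpace H M]
  {F G K : Type*} [NormedAddCommGroup F] [NormedSpace ℝ F] [NormedAddCommGroup G] [NormedSpace ℝ G]
  [NormedAddCommGroup K] [NormedSpace ℝ K]

theorem mvfderiv_congr {f g : M → F} {x : M} (h : f =ᶠ[𝓝 x] g) (v : TangentSpace I x) :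
    mvfderiv I f x v = mvfderiv I g x v :=
  congrArg (fun L : E →L[ℝ] F => L v) h.mfderiv_eq

theorem mvfderiv_clm (L : F →L[ℝ] G) {f : M → F} {x : M} (hf : MDifferentiableAt I 𝓘(ℝ, F) f x)
    (v : TangentSpace I x) : mvfderiv I (fun y => L (f y)) x v = L (mvfderiv I f x v) :=
  mfderiv_comp_apply (I' := 𝓘(ℝ, F)) x (g := L) (f := f) L.mdifferentiableAt hf v |>.trans <| by
    rw [mfderiv_eq_fderiv, L.fderiv]; rfl

theorem mvfderiv_clm_apply_const {f : M → F →L[ℝ] G} {x : M}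
    (hf : MDifferentiableAt I 𝓘(ℝ, F →L[ℝ] G) f x) (c : F) (v : TangentSpace I x) :
    mvfderiv I (fun y => f y c) x v = mvfderiv I f x v c :=
  mvfderiv_clm (ContinuousLinearMap.apply ℝ G c) hf v

/-- The Leibniz rule for a continuous bilinear map. -/
theorem hasMFDerivAt_bilin (B : F →L[ℝ] G →L[ℝ] K) {f : M → F} {g : M → G} {x : M}
    (hf : MDifferentiableAt I 𝓘(ℝ, F) f x) (hg : MDifferentiableAt I 𝓘(ℝ, G) g x) :
    HasMFDerivAt I 𝓘(ℝ, K) (fun y => B (f y) (g y)) x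
      ((B.precompR E (f x) (mvfderiv I g x) + B.precompL E (mvfderiv I f x) (g x) : E →L[ℝ] K)) := by
  have hc : ContinuousAt (fun y => B (f y) (g y)) x :=
    (B.continuous.continuousAt.comp hf.continuousAt).clm_apply hg.continuousAt
  have h := B.hasFDerivWithinAt_of_bilinear hf.hasMFDerivAt.2 hg.hasMFDerivAt.2
  -- At the base point the functions read in charts have the values `f x` and `g x`.
  have hfx : writtenInExtChartAt I 𝓘(ℝ, F) x f (extChartAt I x x) = f x := by
    simp [mfld_simps]; rfl
  have hgx : writtenInExtChartAt I 𝓘(ℝ, G) x g (extChartAt I x x) = g x := by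
    simp [mfld_simps]; rfl
  rw [hfx, hgx] at h
  exact ⟨hc, h⟩

theorem mvfderiv_bilin (B : F →L[ℝ] G →L[ℝ] K) {f : M → F} {g : M → G} {x : M}
    (hf : MDifferentiableAt I 𝓘(ℝ, F) f x) (hg : MDifferentiableAt I 𝓘(ℝ, G) g x)
    (v : TangentSpace I x) :
    mvfderiv I (fun y => B (f y) (g y)) x v
      = B (mvfderiv I f x v) (g x) + B (f x) (mvfderiv I g x v) := by
  have h := (hasMFDerivAt_bilin B hf hg).mfderiv
  refine (congrArg (fun L : E →L[ℝ] K => L v) h).trans ?_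
  exact add_comm _ _

/-- The chain rule for a vector-valued function along a curve. -/
theorem hasDerivAt_comp_curve {f : M → F} {γ : ℝ → M} {t : ℝ}
    (hf : MDifferentiableAt I 𝓘(ℝ, F) f (γ t)) (hγ : MDifferentiableAt 𝓘(ℝ, ℝ) I γ t) :
    HasDerivAt (fun s => f (γ s)) (mvfderiv I f (γ t) (velocity I γ t)) t := by
  have h : HasFDerivAt (fun s => f (γ s)) ((mvfderiv I f (γ t) : E →L[ℝ] F) ∘L
      (mfderiv 𝓘(ℝ, ℝ) I γ t : ℝ →L[ℝ] E)) t :=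
    hasMFDerivAt_iff_hasFDerivAt.1 (hf.hasMFDerivAt.comp t hγ.hasMFDerivAt)
  exact h.hasDerivAt

end VectorValued

/-! ### Coordinates, Christoffel symbols and derivatives along curves -/

section Generic

variable {E : Type*} [NormedAddCommGroup E] [NormedSpace ℝ E]
  {H : Type*} [TopologicalSpace H] {I : ModelWithCorners ℝ E H}
  {M : Type*} [TopologicalSpace M] [ChartedSpace H M] [IsManifold I ∞ M]

theorem coordComp_coordField {x y : M} (hy : y ∈ (chartAt H x).source) (a : E) :
    coordComp I x y (coordField I x y a) = a :=
  (trivializationAt E (TangentSpace I) x).continuousLinearMapAt_symmL (R := ℝ) hy a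

theorem coordField_coordComp {x y : M} (hy : y ∈ (chartAt H x).source) (v : TangentSpace I y) :
    coordField I x y (coordComp I x y v) = v :=
  (trivializationAt E (TangentSpace I) x).symmL_continuousLinearMapAt (R := ℝ) hy v

theorem eventually_mem_chartAt_source (x : M) : ∀ᶠ y in 𝓝 x, y ∈ (chartAt H x).source :=
  (chartAt H x).open_source.mem_nhds (mem_chart_source H x)

theorem coordComp_eq_trivializationAt {x y : M} (hy : y ∈ (chartAt H x).source)
    (v : TangentSpace I y) :
    coordComp I x y v = (trivializationAt E (TangentSpace I) x ⟨y, v⟩).2 :=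
  Bundle.Trivialization.continuousLinearMapAt_apply_of_mem (R := ℝ)
    (trivializationAt E (TangentSpace I) x) hy v

theorem Metric.mdifferentiableAt_coord (g : Metric I M) (x : M) :
    MDifferentiableAt I 𝓘(ℝ, E →L[ℝ] E →L[ℝ] ℝ) (g.coord x) x := by
  have h := ((contMDiffAt_hom_bundle _).1 (g.contMDiff x)).2
  refine (h.congr_of_eventuallyEq ?_).mdifferentiableAt (by simp)
  filter_upwards [eventually_mem_chartAt_source (H := H) x] with y hy
  refine ContinuousLinearMap.ext fun a => ContinuousLinearMap.ext fun b => ?_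
  refine ((inCoordinates_apply_eq₂ (ϕ := g.inner y) (x₀ := x) (v := a) (w := b)
    (F₃ := ℝ) (E₃ := Bundle.Trivial M ℝ) hy hy (Set.mem_univ _)).trans ?_).symm
  simp only [Bundle.Trivial.fiberBundle_trivializationAt',
    Bundle.Trivial.linearMapAt_trivialization, LinearMap.id_coe, id_eq]
  rw [coordField_eq_symm hy, coordField_eq_symm hy]
  rfl

theorem Metric.mdifferentiableAt_coord_apply (g : Metric I M) (x : M) (a b : E) :
    MDifferentiableAt I 𝓘(ℝ, ℝ) (fun y => g.coord x y a b) x :=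
  ((g.mdifferentiableAt_coord x).clm_apply mdifferentiableAt_const).clm_apply
    mdifferentiableAt_const

theorem Metric.coordDeriv_apply (g : Metric I M) (x : M) (u : TangentSpace I x) (a b : E) :
    g.coordDeriv x u a b = mvfderiv I (fun y => g.coord x y a b) x u := by
  rw [mvfderiv_clm_apply_const ((g.mdifferentiableAt_coord x).clm_apply mdifferentiableAt_const),
    mvfderiv_clm_apply_const (g.mdifferentiableAt_coord x)]
  rfl

theorem Metric.coord_coordComp (g : Metric I M) (x : M) (v w : TangentSpace I x) :
    g.coord x x (coordComp I x x v) (coordComp I x x w) = g.inner x v w := by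
  rw [g.coord_apply, coordField_coordComp (mem_chart_source H x),
    coordField_coordComp (mem_chart_source H x)]

section FiniteDimensional

variable [FiniteDimensional ℝ E]

omit [FiniteDimensional ℝ E] in
theorem Metric.ext_inner (g : Metric I M) {x : M} {v w : TangentSpace I x}
    (h : ∀ z, g.inner x v z = g.inner x w z) : v = w :=
  g.form_injective x (LinearMap.ext h)

theorem Metric.inner_christoffel (g : Metric I M) (x : M) (u v w : TangentSpace I x) :
    g.inner x (g.christoffel x u v) w = g.christoffelForm x u v w :=
  g.inner_sharp x _ w

theorem Metric.christoffel_add_left (g : Metric I M) (x : M) (u u' v : TangentSpace I x) :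
    g.christoffel x (u + u') v = g.christoffel x u v + g.christoffel x u' v := by
  refine g.ext_inner fun w => ?_
  rw [map_add, add_apply, g.inner_christoffel, g.inner_christoffel, g.inner_christoffel]
  simp only [Metric.christoffelForm, LinearMap.coe_mk, AddHom.coe_mk, map_add, add_apply]
  ring

theorem Metric.christoffel_add_right (g : Metric I M) (x : M) (u v v' : TangentSpace I x) :
    g.christoffel x u (v + v') = g.christoffel x u v + g.christoffel x u v' := by
  refine g.ext_inner fun w => ?_
  rw [map_add, add_apply, g.inner_christoffel, g.inner_christoffel, g.inner_christoffel]
  simp only [Metric.christoffelForm, LinearMap.coe_mk, AddHom.coe_mk, map_add, add_apply]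
  ring

theorem Metric.christoffel_zero_right (g : Metric I M) (x : M) (u : TangentSpace I x) :
    g.christoffel x u 0 = 0 := by
  simpa using g.christoffel_add_right x u 0 0

theorem Metric.nabla_add (g : Metric I M) (X : ∀ y : M, TangentSpace I y) (x : M)
    (v w : TangentSpace I x) : g.nabla X x (v + w) = g.nabla X x v + g.nabla X x w := by
  unfold Metric.nabla
  rw [map_add, map_add, g.christoffel_add_left]
  abel

variable (I) in
/-- The components of the field `W` along `γ`, in the preferred chart around `γ t`, are
differentiable at time `t`. -/
def DiffAlongAt (γ : ℝ → M) (W : ∀ s : ℝ, TangentSpace I (γ s)) (t : ℝ) : Prop :=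
  DifferentiableAt ℝ (fun s => coordComp I (γ t) (γ s) (W s)) t

theorem Metric.covDerivAlong_add (g : Metric I M) {γ : ℝ → M}
    {V W : ∀ s : ℝ, TangentSpace I (γ s)} {t : ℝ} (hV : DiffAlongAt I γ V t)
    (hW : DiffAlongAt I γ W t) :
    g.covDerivAlong γ (fun s => V s + W s) t = g.covDerivAlong γ V t + g.covDerivAlong γ W t := by
  unfold Metric.covDerivAlong
  have : deriv (fun s => coordComp I (γ t) (γ s) (V s + W s)) t
      = deriv (fun s => coordComp I (γ t) (γ s) (V s)) t
        + deriv (fun s => coordComp I (γ t) (γ s) (W s)) t := by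
    rw [← deriv_fun_add hV hW]
    simp only [map_add]
  rw [this, map_add, g.christoffel_add_right]
  abel

theorem Metric.covDerivAlong_congr (g : Metric I M) {γ : ℝ → M}
    {V W : ∀ s : ℝ, TangentSpace I (γ s)} {t : ℝ} (h : ∀ᶠ s in 𝓝 t, V s = W s) :
    g.covDerivAlong γ V t = g.covDerivAlong γ W t := by
  have e : (fun s => coordComp I (γ t) (γ s) (V s))
      =ᶠ[𝓝 t] fun s => coordComp I (γ t) (γ s) (W s) := by
    filter_upwards [h] with s hs
    rw [hs]
  unfold Metric.covDerivAlong
  rw [e.deriv_eq, h.self_of_nhds]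

theorem Metric.covDerivAlong_eq_zero (g : Metric I M) {γ : ℝ → M}
    {V : ∀ s : ℝ, TangentSpace I (γ s)} {t : ℝ} (h : ∀ᶠ s in 𝓝 t, V s = 0) :
    g.covDerivAlong γ V t = 0 := by
  rw [g.covDerivAlong_congr (W := fun _ => 0) h]
  unfold Metric.covDerivAlong
  simp [g.christoffel_zero_right]

omit [FiniteDimensional ℝ E] in
theorem mdifferentiableAt_coordComp_of_contMDiffAt {X : ∀ y : M, TangentSpace I y} {x : M}
    (hX : ContMDiffAt I (I.prod 𝓘(ℝ, E)) ∞ (fun y => Bundle.TotalSpace.mk' E y (X y)) x) :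
    MDifferentiableAt I 𝓘(ℝ, E) (fun y => coordComp I x y (X y)) x := by
  have h := (Bundle.contMDiffAt_section x).1 hX
  refine (h.congr_of_eventuallyEq ?_).mdifferentiableAt (by simp)
  filter_upwards [eventually_mem_chartAt_source (H := H) x] with y hy
  exact coordComp_eq_trivializationAt hy _

/-- The covariant derivative along a curve is that of any local extension of the field. -/
theorem Metric.nabla_velocity_of_extension (g : Metric I M) {γ : ℝ → M}
    (W : ∀ s : ℝ, TangentSpace I (γ s)) {t : ℝ}
    {X : ∀ y : M, TangentSpace I y} (hγ : MDifferentiableAt 𝓘(ℝ, ℝ) I γ t)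
    (hX : IsLocalExtensionAt I γ W t X) :
    g.nabla X (γ t) (velocity I γ t) = g.covDerivAlong γ W t := by
  rw [← g.covDerivAlong_congr hX.2]
  unfold Metric.nabla Metric.covDerivAlong
  rw [(hasDerivAt_comp_curve (mdifferentiableAt_coordComp_of_contMDiffAt hX.1) hγ).deriv]

omit [FiniteDimensional ℝ E] in
theorem diffAlongAt_velocity {γ : ℝ → M} {t : ℝ} (hγ : ContMDiffAt 𝓘(ℝ, ℝ) I ∞ γ t) :
    DiffAlongAt I γ (velocity I γ) t := by
  -- `∞ + 1 = ∞`: the derivative of a smooth map is smooth.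
  have h := hγ.mfderiv_const (m := ∞) le_rfl
  have h1 : DifferentiableAt ℝ (inTangentCoordinates 𝓘(ℝ, ℝ) I id γ
      (fun s => mfderiv 𝓘(ℝ, ℝ) I γ s) t) t :=
    (h.mdifferentiableAt (by simp)).differentiableAt
  refine (h1.clm_apply (differentiableAt_const (1 : ℝ))).congr_of_eventuallyEq ?_
  have hs := hγ.continuousAt.eventually (eventually_mem_chartAt_source (H := H) (γ t))
  filter_upwards [hs] with s hs
  have e := inTangentCoordinates_eq (I := 𝓘(ℝ, ℝ)) (I' := I) id γ
    (fun s => mfderiv 𝓘(ℝ, ℝ) I γ s) (x₀ := t) (x := s) (Set.mem_univ _) hs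
  unfold coordComp
  rw [TangentBundle.continuousLinearMapAt_trivializationAt_eq_core hs, e,
    TangentBundle.coordChange_model_space]
  rfl

end FiniteDimensional
end Generic

/-! ### Projections of a Riemannian map -/

section Generic

variable {E : Type*} [NormedAddCommGroup E] [NormedSpace ℝ E] [FiniteDimensional ℝ E]
  {H : Type*} [TopologicalSpace H] {I : ModelWithCorners ℝ E H}
  {M : Type*} [TopologicalSpace M] [ChartedSpace H M] [IsManifold I ∞ M]
  {E' : Type*} [NormedAddCommGroup E'] [NormedSpace ℝ E']
  {H' : Type*} [TopologicalSpace H'] {I' : ModelWithCorners ℝ E' H'}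
  {N : Type*} [TopologicalSpace N] [ChartedSpace H' N] [IsManifold I' ∞ N]

section Pointwise

variable (g : Metric I M) (φ : M → N) (x : M)

theorem vertProj_mem (v : TangentSpace I x) : vertProj I' g φ x v ∈ vertical I I' φ x :=
  Submodule.projection_apply_mem _ v

theorem horProj_mem (v : TangentSpace I x) : horProj I' g φ x v ∈ horizontal I' g φ x :=
  Submodule.projection_apply_mem _ v

theorem vertProj_add_horProj (v : TangentSpace I x) :
    vertProj I' g φ x v + horProj I' g φ x v = v :=
  Submodule.projection_add_projection_eq_self (isCompl_vertical_horizontal g φ x) v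

variable {g φ x}

theorem vertProj_of_mem_vertical {v : TangentSpace I x} (hv : v ∈ vertical I I' φ x) :
    vertProj I' g φ x v = v :=
  Submodule.projection_apply_of_mem_left _ hv

theorem horProj_of_mem_horizontal {v : TangentSpace I x} (hv : v ∈ horizontal I' g φ x) :
    horProj I' g φ x v = v :=
  Submodule.projection_apply_of_mem_left _ hv

theorem vertProj_of_mem_horizontal {v : TangentSpace I x} (hv : v ∈ horizontal I' g φ x) :
    vertProj I' g φ x v = 0 :=
  Submodule.projection_apply_of_mem_right _ hv

theorem horProj_of_mem_vertical {v : TangentSpace I x} (hv : v ∈ vertical I I' φ x) :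
    horProj I' g φ x v = 0 :=
  Submodule.projection_apply_of_mem_right _ hv

omit [FiniteDimensional ℝ E] [IsManifold I' ∞ N] in
theorem inner_vertical_horizontal {v w : TangentSpace I x} (hv : v ∈ vertical I I' φ x)
    (hw : w ∈ horizontal I' g φ x) : g.inner x v w = 0 :=
  (LinearMap.BilinForm.mem_orthogonal_iff.1 hw) v hv

theorem vertProj_eq_zero_and_horProj_eq_zero_iff {v : TangentSpace I x} :
    (vertProj I' g φ x v = 0 ∧ horProj I' g φ x v = 0) ↔ v = 0 := by
  refine ⟨fun h => ?_, fun h => by rw [h, map_zero, map_zero]; exact ⟨rfl, rfl⟩⟩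
  rw [← vertProj_add_horProj (I' := I') g φ x v, h.1, h.2, add_zero]

theorem inner_eq_vertProj_add_horProj (v : TangentSpace I x) :
    g.inner x v v = g.inner x (vertProj I' g φ x v) (vertProj I' g φ x v)
      + g.inner x (horProj I' g φ x v) (horProj I' g φ x v) := by
  have h := inner_vertical_horizontal (vertProj_mem (I' := I') g φ x v) (horProj_mem g φ x v)
  have h' := h
  rw [g.symm] at h'
  conv_lhs => rw [← vertProj_add_horProj (I' := I') g φ x v]
  simp only [map_add, add_apply]
  rw [h, h']
  ring

end Pointwise

/-- For a Riemannian map the horizontal projection is `g⁻¹ (φ^* h)`. -/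
theorem IsRiemannianMap.inner_horProj {g : Metric I M} {h : Metric I' N} {φ : M → N}
    (hφ : IsRiemannianMap g h φ) (x : M) (v w : TangentSpace I x) :
    g.inner x (horProj I' g φ x v) w
      = h.inner (φ x) (mfderiv I I' φ x v) (mfderiv I I' φ x w) := by
  -- `φ_*` only sees the horizontal part, on which it is an isometry.
  have hd : ∀ u, mfderiv I I' φ x u = mfderiv I I' φ x (horProj I' g φ x u) := by
    intro u
    have hu : mfderiv I I' φ x (vertProj I' g φ x u) = 0 :=
      LinearMap.mem_ker.1 (vertProj_mem g φ x u)
    conv_lhs => rw [← vertProj_add_horProj (I' := I') g φ x u]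
    rw [map_add, hu, zero_add]
  have h0 := inner_vertical_horizontal (vertProj_mem (I' := I') g φ x w) (horProj_mem g φ x v)
  rw [g.symm] at h0
  rw [hd v, hd w, hφ.isometry x _ (horProj_mem g φ x v) _ (horProj_mem g φ x w)]
  conv_lhs => rw [← vertProj_add_horProj (I' := I') g φ x w]
  rw [map_add, h0, zero_add]

variable (I') in
/-- The matrix of the horizontal projection at `y` in the preferred chart around `x`. -/
def horCoord (g : Metric I M) (φ : M → N) (x y : M) : E →L[ℝ] E :=
  LinearMap.toContinuousLinearMap (E := E) (F' := E)
    ((coordComp I x y : TangentSpace I y →ₗ[ℝ] E) ∘ₗ horProj I' g φ y ∘ₗ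
      (coordField I x y : E →ₗ[ℝ] TangentSpace I y))

theorem horCoord_apply (g : Metric I M) (φ : M → N) (x y : M) (a : E) :
    horCoord I' g φ x y a = coordComp I x y (horProj I' g φ y (coordField I x y a)) := rfl

theorem Metric.isInvertible_coord (g : Metric I M) {x y : M} (hy : y ∈ (chartAt H x).source) :
    (g.coord x y).IsInvertible := by
  have hinj : Function.Injective (g.coord x y : E →ₗ[ℝ] E →L[ℝ] ℝ) := by
    rw [injective_iff_map_eq_zero]
    intro a ha
    by_contra hne
    have hv : coordField I x y a ≠ 0 := fun h0 => hne <| by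
      rw [← coordComp_coordField (I := I) hy a, h0, map_zero]
    have := g.pos y _ hv
    rw [← g.coord_apply] at this
    have h0 : g.coord x y a = 0 := ha
    rw [h0] at this
    simp at this
  have hdim : Module.finrank ℝ E = Module.finrank ℝ (E →L[ℝ] ℝ) :=
    Subspace.dual_finrank_eq.symm.trans
      (LinearMap.toContinuousLinearMap (𝕜 := ℝ) (E := E) (F' := ℝ)).finrank_eq
  exact ⟨(LinearMap.linearEquivOfInjective _ hinj hdim).toContinuousLinearEquiv,
    ContinuousLinearMap.ext fun a => rfl⟩

/-- The horizontal projection of a Riemannian map depends differentiably on the point. It is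
`g⁻¹ (φ^* h)`, so that no argument about the rank of `φ` is needed. -/
theorem IsRiemannianMap.mdifferentiableAt_horCoord {g : Metric I M} {h : Metric I' N} {φ : M → N}
    (hφ : IsRiemannianMap g h φ) (x : M) :
    MDifferentiableAt I 𝓘(ℝ, E →L[ℝ] E) (horCoord I' g φ x) x := by
  -- The matrix of `φ_*` in the charts around `x` and `φ x`.
  have hD : MDifferentiableAt I 𝓘(ℝ, E →L[ℝ] E')
      (inTangentCoordinates I I' id φ (fun y => mfderiv I I' φ y) x) x :=
    ((hφ.contMDiff x).mfderiv_const (m := ∞) le_rfl).mdifferentiableAt (by simp)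
  have hh : MDifferentiableAt I 𝓘(ℝ, E' →L[ℝ] E' →L[ℝ] ℝ) (fun y => h.coord (φ x) (φ y)) x :=
    (h.mdifferentiableAt_coord (φ x)).comp x ((hφ.contMDiff x).mdifferentiableAt (by simp))
  -- The matrix of `φ^* h`.
  have hS := (hD.clm_precomp (F₃ := ℝ)).clm_comp (hh.clm_comp hD)
  have hinv : MDifferentiableAt I 𝓘(ℝ, (E →L[ℝ] ℝ) →L[ℝ] E)
      (fun y => (g.coord x y).inverse) x :=
    MDifferentiableAt.comp x (I' := 𝓘(ℝ, E →L[ℝ] E →L[ℝ] ℝ))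
      (((g.isInvertible_coord (mem_chart_source H x)).contDiffAt_map_inverse
        (n := 1)).differentiableAt one_ne_zero).mdifferentiableAt (g.mdifferentiableAt_coord x)
  refine (hinv.clm_comp hS).congr_of_eventuallyEq ?_
  filter_upwards [eventually_mem_chartAt_source (H := H) x,
    (hφ.contMDiff x).continuousAt.eventually (eventually_mem_chartAt_source (H := H') (φ x))]
    with y hy hy'
  refine ContinuousLinearMap.ext fun a => ?_
  have key : g.coord x y (horCoord I' g φ x y a)
      = ((inTangentCoordinates I I' id φ (fun y => mfderiv I I' φ y) x y).precomp ℝ ∘L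
        h.coord (φ x) (φ y) ∘L
        inTangentCoordinates I I' id φ (fun y => mfderiv I I' φ y) x y) a := by
    refine ContinuousLinearMap.ext fun b => ?_
    have hc : ∀ c, coordField I' (φ x) (φ y)
        (inTangentCoordinates I I' id φ (fun y => mfderiv I I' φ y) x y c)
        = mfderiv I I' φ y (coordField I x y c) := fun c =>
      coordField_coordComp hy' (mfderiv I I' φ y (coordField I x y c))
    rw [g.coord_apply, horCoord_apply, coordField_coordComp hy, hφ.inner_horProj, ← hc, ← hc]
    rfl
  obtain ⟨e, he⟩ := g.isInvertible_coord hy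
  have h2 : (g.coord x y).inverse (g.coord x y (horCoord I' g φ x y a)) = horCoord I' g φ x y a := by
    rw [← he, ContinuousLinearMap.inverse_equiv]
    exact e.symm_apply_apply _
  rw [← h2, key]
  rfl

/-! ### O'Neill's tensors -/

section Derivative

variable {g : Metric I M} {φ : M → N}

theorem horCoord_comp_self {x y : M} (hy : y ∈ (chartAt H x).source) (a : E) :
    horCoord I' g φ x y (horCoord I' g φ x y a) = horCoord I' g φ x y a := by
  rw [horCoord_apply, horCoord_apply, coordField_coordComp hy,
    horProj_of_mem_horizontal (horProj_mem g φ y _)]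

theorem coordComp_horProj {x y : M} (hy : y ∈ (chartAt H x).source) (v : TangentSpace I y) :
    coordComp I x y (horProj I' g φ y v) = horCoord I' g φ x y (coordComp I x y v) := by
  rw [horCoord_apply, coordField_coordComp hy]

theorem coordComp_vertProj {x y : M} (hy : y ∈ (chartAt H x).source) (v : TangentSpace I y) :
    coordComp I x y (vertProj I' g φ y v)
      = coordComp I x y v - horCoord I' g φ x y (coordComp I x y v) := by
  rw [← coordComp_horProj hy, eq_sub_iff_add_eq, ← map_add, vertProj_add_horProj]

theorem horProj_coordField (x : M) (a : E) :
    horProj I' g φ x (coordField I x x a) = coordField I x x (horCoord I' g φ x x a) := by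
  rw [horCoord_apply, coordField_coordComp (mem_chart_source H x)]

theorem vertProj_coordField (x : M) (a : E) :
    vertProj I' g φ x (coordField I x x a)
      = coordField I x x (a - horCoord I' g φ x x a) := by
  rw [map_sub, ← horProj_coordField, eq_sub_iff_add_eq, vertProj_add_horProj]

/-- The derivative of the identity `ℋ² = ℋ`. -/
theorem mvfderiv_horCoord_apply {x : M}
    (hQ : MDifferentiableAt I 𝓘(ℝ, E →L[ℝ] E) (horCoord I' g φ x) x) (w : TangentSpace I x)
    (a : E) :
    mvfderiv I (horCoord I' g φ x) x w a
      = mvfderiv I (horCoord I' g φ x) x w (horCoord I' g φ x x a)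
        + horCoord I' g φ x x (mvfderiv I (horCoord I' g φ x) x w a) := by
  have h1 := mvfderiv_bilin (ContinuousLinearMap.compL ℝ E E E) hQ hQ w
  have h2 : (fun y => ContinuousLinearMap.compL ℝ E E E (horCoord I' g φ x y)
      (horCoord I' g φ x y)) =ᶠ[𝓝 x] horCoord I' g φ x := by
    filter_upwards [eventually_mem_chartAt_source (H := H) x] with y hy
    exact ContinuousLinearMap.ext fun b => horCoord_comp_self hy b
  rw [mvfderiv_congr h2] at h1
  exact congrArg (fun L : E →L[ℝ] E => L a) h1

/-- `ℋ ∘ dℋ ∘ ℋ = 0`. -/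
theorem horCoord_mvfderiv_horCoord {x : M}
    (hQ : MDifferentiableAt I 𝓘(ℝ, E →L[ℝ] E) (horCoord I' g φ x) x) (w : TangentSpace I x)
    (a : E) :
    horCoord I' g φ x x (mvfderiv I (horCoord I' g φ x) x w (horCoord I' g φ x x a)) = 0 := by
  have h := mvfderiv_horCoord_apply hQ w (horCoord I' g φ x x a)
  rw [horCoord_comp_self (mem_chart_source H x)] at h
  simpa using h

variable (g φ) in
theorem nabla_horProj_coordField {x : M}
    (hQ : MDifferentiableAt I 𝓘(ℝ, E →L[ℝ] E) (horCoord I' g φ x) x) (w : TangentSpace I x)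
    (c : E) : g.nabla (fun y => horProj I' g φ y (coordField I x y c)) x w
      = coordField I x x (mvfderiv I (horCoord I' g φ x) x w c)
        + g.christoffel x w (horProj I' g φ x (coordField I x x c)) := by
  rw [← mvfderiv_clm_apply_const hQ]
  rfl

variable (g φ) in
theorem nabla_vertProj_coordField {x : M}
    (hQ : MDifferentiableAt I 𝓘(ℝ, E →L[ℝ] E) (horCoord I' g φ x) x) (w : TangentSpace I x)
    (c : E) : g.nabla (fun y => vertProj I' g φ y (coordField I x y c)) x w
      = coordField I x x (-(mvfderiv I (horCoord I' g φ x) x w c))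
        + g.christoffel x w (vertProj I' g φ x (coordField I x x c)) := by
  unfold Metric.nabla
  congr 2
  have e : (fun y => coordComp I x y (vertProj I' g φ y (coordField I x y c)))
      =ᶠ[𝓝 x] fun y => c - horCoord I' g φ x y c := by
    filter_upwards [eventually_mem_chartAt_source (H := H) x] with y hy
    rw [coordComp_vertProj hy, coordComp_coordField hy]
  rw [mvfderiv_congr e, mvfderiv_fun_sub mdifferentiableAt_const
    (hQ.clm_apply mdifferentiableAt_const), mvfderiv_const, zero_sub, neg_apply,
    mvfderiv_clm_apply_const hQ]

variable (I') in
/-- `ℋ ∇_w 𝒱 v + 𝒱 ∇_w ℋ v`, where `v` is extended to a vector field with constant components in the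
preferred chart around `x`. O'Neill's `T` and `A` are its values for vertical and for horizontal
directions `w`. -/
def oneillDir (g : Metric I M) (φ : M → N) (x : M) (w v : TangentSpace I x) : TangentSpace I x :=
  horProj I' g φ x (g.nabla (fun y => vertProj I' g φ y (coordField I x y (coordComp I x x v))) x w)
    + vertProj I' g φ x
      (g.nabla (fun y => horProj I' g φ y (coordField I x y (coordComp I x x v))) x w)

theorem oneillT_eq_oneillDir (x : M) (u v : TangentSpace I x) :
    oneillT I' g φ x u v = oneillDir I' g φ x (vertProj I' g φ x u) v := by
  unfold oneillT oneillTField oneillDir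
  beta_reduce
  rw [coordField_coordComp (mem_chart_source H x) u]

theorem oneillA_eq_oneillDir (x : M) (u v : TangentSpace I x) :
    oneillA I' g φ x u v = oneillDir I' g φ x (horProj I' g φ x u) v := by
  unfold oneillA oneillAField oneillDir
  beta_reduce
  rw [coordField_coordComp (mem_chart_source H x) u]

theorem oneillDir_add (x : M) (w w' v : TangentSpace I x) :
    oneillDir I' g φ x (w + w') v = oneillDir I' g φ x w v + oneillDir I' g φ x w' v := by
  unfold oneillDir
  rw [g.nabla_add, g.nabla_add, map_add, map_add]
  abel

theorem oneillDir_zero_left (x : M) (v : TangentSpace I x) : oneillDir I' g φ x 0 v = 0 := by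
  simpa using oneillDir_add (I' := I') (g := g) (φ := φ) x 0 0 v

theorem oneillDir_zero_right (x : M) (w : TangentSpace I x) : oneillDir I' g φ x w 0 = 0 := by
  have h0 : g.nabla (fun _ => 0) x w = 0 := by
    unfold Metric.nabla
    simp only [map_zero, g.christoffel_zero_right, add_zero]
    rw [mvfderiv_const, zero_apply, map_zero]
  unfold oneillDir
  simp only [map_zero, h0, add_zero]

theorem oneillT_add_oneillA (x : M) (w v : TangentSpace I x) :
    oneillT I' g φ x (vertProj I' g φ x w) v + oneillA I' g φ x (horProj I' g φ x w) v
      = oneillDir I' g φ x w v := by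
  rw [oneillT_eq_oneillDir, oneillA_eq_oneillDir, vertProj_of_mem_vertical (vertProj_mem g φ x w),
    horProj_of_mem_horizontal (horProj_mem g φ x w), ← oneillDir_add, vertProj_add_horProj]

theorem oneillT_zero_left (x : M) (v : TangentSpace I x) : oneillT I' g φ x 0 v = 0 := by
  rw [oneillT_eq_oneillDir, map_zero, oneillDir_zero_left]

theorem oneillT_zero_right (x : M) (u : TangentSpace I x) : oneillT I' g φ x u 0 = 0 := by
  rw [oneillT_eq_oneillDir, oneillDir_zero_right]

theorem oneillA_zero_left (x : M) (v : TangentSpace I x) : oneillA I' g φ x 0 v = 0 := by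
  rw [oneillA_eq_oneillDir, map_zero, oneillDir_zero_left]

theorem oneillA_zero_right (x : M) (u : TangentSpace I x) : oneillA I' g φ x u 0 = 0 := by
  rw [oneillA_eq_oneillDir, oneillDir_zero_right]

/-- On vertical `v` only the term `ℋ ∇_w (𝒱 v)` remains: as `ℋ v = 0`, the derivative `dℋ(w) v` is
horizontal. -/
theorem oneillDir_vertProj {x : M}
    (hQ : MDifferentiableAt I 𝓘(ℝ, E →L[ℝ] E) (horCoord I' g φ x) x) (w v : TangentSpace I x) :
    oneillDir I' g φ x w (vertProj I' g φ x v)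
      = horProj I' g φ x
        (coordField I x x (-(mvfderiv I (horCoord I' g φ x) x w (coordComp I x x v)))
          + g.christoffel x w (vertProj I' g φ x v)) := by
  have hx := mem_chart_source H x
  have hV := vertProj_of_mem_vertical (g := g) (vertProj_mem (I' := I') g φ x v)
  have hH := horProj_of_mem_vertical (g := g) (vertProj_mem (I' := I') g φ x v)
  -- `dℋ(w) v = ℋ (dℋ(w) v)` for vertical `v`
  have h1 := mvfderiv_horCoord_apply hQ w (coordComp I x x (vertProj I' g φ x v))
  rw [← coordComp_horProj hx, hH, map_zero, map_zero, zero_add] at h1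
  unfold oneillDir
  rw [nabla_horProj_coordField g φ hQ, nabla_vertProj_coordField g φ hQ,
    coordField_coordComp hx, hV, hH, g.christoffel_zero_right, add_zero, vertProj_coordField,
    ← h1, sub_self, map_zero, add_zero, map_add, map_add, horProj_coordField, horProj_coordField,
    coordComp_vertProj hx]
  simp only [map_neg, map_sub, horCoord_mvfderiv_horCoord hQ, sub_zero]

/-- On horizontal `v` only the term `𝒱 ∇_w (ℋ v)` remains: as `ℋ v = v`, the derivative `dℋ(w) v` is
vertical. -/
theorem oneillDir_horProj {x : M}
    (hQ : MDifferentiableAt I 𝓘(ℝ, E →L[ℝ] E) (horCoord I' g φ x) x) (w v : TangentSpace I x) :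
    oneillDir I' g φ x w (horProj I' g φ x v)
      = vertProj I' g φ x
        (coordField I x x (mvfderiv I (horCoord I' g φ x) x w (coordComp I x x v))
          + g.christoffel x w (horProj I' g φ x v)) := by
  have hx := mem_chart_source H x
  have hV := vertProj_of_mem_horizontal (horProj_mem (I' := I') g φ x v)
  have hH := horProj_of_mem_horizontal (horProj_mem (I' := I') g φ x v)
  have h1 := mvfderiv_horCoord_apply hQ w (coordComp I x x v)
  unfold oneillDir
  rw [nabla_horProj_coordField g φ hQ, nabla_vertProj_coordField g φ hQ,
    coordField_coordComp hx, hV, hH, g.christoffel_zero_right, add_zero, coordComp_horProj hx,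
    horProj_coordField, map_neg, horCoord_mvfderiv_horCoord hQ, neg_zero, map_zero, zero_add,
    map_add, map_add, vertProj_coordField, vertProj_coordField, horCoord_mvfderiv_horCoord hQ,
    sub_zero, sub_eq_of_eq_add h1]

end Derivative

/-! ### Vertical and horizontal fields along a curve -/

section Curve

variable {g : Metric I M} {φ : M → N} {γ : ℝ → M} {W : ∀ s : ℝ, TangentSpace I (γ s)} {t : ℝ}

theorem hasDerivAt_coordComp_horProj
    (hQ : MDifferentiableAt I 𝓘(ℝ, E →L[ℝ] E) (horCoord I' g φ (γ t)) (γ t))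
    (hγ : MDifferentiableAt 𝓘(ℝ, ℝ) I γ t) (hW : DiffAlongAt I γ W t) :
    HasDerivAt (fun s => coordComp I (γ t) (γ s) (horProj I' g φ (γ s) (W s)))
      (mvfderiv I (horCoord I' g φ (γ t)) (γ t) (velocity I γ t) (coordComp I (γ t) (γ t) (W t))
        + horCoord I' g φ (γ t) (γ t) (deriv (fun s => coordComp I (γ t) (γ s) (W s)) t)) t := by
  refine ((hasDerivAt_comp_curve hQ hγ).clm_apply hW.hasDerivAt).congr_of_eventuallyEq ?_
  filter_upwards [hγ.continuousAt.eventually (eventually_mem_chartAt_source (H := H) (γ t))]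
    with s hs
  exact coordComp_horProj hs _

theorem hasDerivAt_coordComp_vertProj
    (hQ : MDifferentiableAt I 𝓘(ℝ, E →L[ℝ] E) (horCoord I' g φ (γ t)) (γ t))
    (hγ : MDifferentiableAt 𝓘(ℝ, ℝ) I γ t) (hW : DiffAlongAt I γ W t) :
    HasDerivAt (fun s => coordComp I (γ t) (γ s) (vertProj I' g φ (γ s) (W s)))
      (deriv (fun s => coordComp I (γ t) (γ s) (W s)) t
        - (mvfderiv I (horCoord I' g φ (γ t)) (γ t) (velocity I γ t)
            (coordComp I (γ t) (γ t) (W t))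
          + horCoord I' g φ (γ t) (γ t) (deriv (fun s => coordComp I (γ t) (γ s) (W s)) t))) t := by
  refine (hW.hasDerivAt.sub (hasDerivAt_coordComp_horProj hQ hγ hW)).congr_of_eventuallyEq ?_
  filter_upwards [hγ.continuousAt.eventually (eventually_mem_chartAt_source (H := H) (γ t))]
    with s hs
  rw [coordComp_vertProj hs, Pi.sub_apply, coordComp_horProj hs]

/-- The horizontal part of the derivative of a vertical field along a curve is tensorial. -/
theorem horProj_covDerivAlong_vertProj
    (hQ : MDifferentiableAt I 𝓘(ℝ, E →L[ℝ] E) (horCoord I' g φ (γ t)) (γ t))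
    (hγ : MDifferentiableAt 𝓘(ℝ, ℝ) I γ t) (hW : DiffAlongAt I γ W t) :
    horProj I' g φ (γ t) (g.covDerivAlong γ (fun s => vertProj I' g φ (γ s) (W s)) t)
      = oneillDir I' g φ (γ t) (velocity I γ t) (vertProj I' g φ (γ t) (W t)) := by
  rw [oneillDir_vertProj hQ]
  unfold Metric.covDerivAlong
  rw [(hasDerivAt_coordComp_vertProj hQ hγ hW).deriv, map_add, map_add, horProj_coordField,
    horProj_coordField]
  simp only [map_sub, map_add, map_neg, horCoord_comp_self (mem_chart_source H (γ t))]
  abel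

/-- The vertical part of the derivative of a horizontal field along a curve is tensorial. -/
theorem vertProj_covDerivAlong_horProj
    (hQ : MDifferentiableAt I 𝓘(ℝ, E →L[ℝ] E) (horCoord I' g φ (γ t)) (γ t))
    (hγ : MDifferentiableAt 𝓘(ℝ, ℝ) I γ t) (hW : DiffAlongAt I γ W t) :
    vertProj I' g φ (γ t) (g.covDerivAlong γ (fun s => horProj I' g φ (γ s) (W s)) t)
      = oneillDir I' g φ (γ t) (velocity I γ t) (horProj I' g φ (γ t) (W t)) := by
  rw [oneillDir_horProj hQ]
  unfold Metric.covDerivAlong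
  rw [(hasDerivAt_coordComp_horProj hQ hγ hW).deriv, map_add (vertProj I' g φ (γ t)),
    map_add (vertProj I' g φ (γ t)), vertProj_coordField, vertProj_coordField]
  simp only [map_sub, map_add, horCoord_comp_self (mem_chart_source H (γ t))]
  abel

theorem covDerivAlong_eq_vertProj_add_horProj
    (hQ : MDifferentiableAt I 𝓘(ℝ, E →L[ℝ] E) (horCoord I' g φ (γ t)) (γ t))
    (hγ : MDifferentiableAt 𝓘(ℝ, ℝ) I γ t) (hW : DiffAlongAt I γ W t) :
    g.covDerivAlong γ W t
      = g.covDerivAlong γ (fun s => vertProj I' g φ (γ s) (W s)) t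
        + g.covDerivAlong γ (fun s => horProj I' g φ (γ s) (W s)) t := by
  rw [← g.covDerivAlong_add (hasDerivAt_coordComp_vertProj hQ hγ hW).differentiableAt
    (hasDerivAt_coordComp_horProj hQ hγ hW).differentiableAt]
  simp only [vertProj_add_horProj]

/-- The vertical part of the acceleration of a curve. -/
theorem vertProj_covDerivAlong_velocity
    (hQ : MDifferentiableAt I 𝓘(ℝ, E →L[ℝ] E) (horCoord I' g φ (γ t)) (γ t))
    (hγ : ContMDiffAt 𝓘(ℝ, ℝ) I ∞ γ t) :
    vertProj I' g φ (γ t) (g.covDerivAlong γ (velocity I γ) t)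
      = vertProj I' g φ (γ t)
          (g.covDerivAlong γ (fun s => vertProj I' g φ (γ s) (velocity I γ s)) t)
        + oneillT I' g φ (γ t) (vertProj I' g φ (γ t) (velocity I γ t))
          (horProj I' g φ (γ t) (velocity I γ t))
        + oneillA I' g φ (γ t) (horProj I' g φ (γ t) (velocity I γ t))
          (horProj I' g φ (γ t) (velocity I γ t)) := by
  have hγ' := hγ.mdifferentiableAt (by simp)
  have hW := diffAlongAt_velocity hγ
  rw [add_assoc, oneillT_add_oneillA, ← vertProj_covDerivAlong_horProj hQ hγ' hW, ← map_add,
    ← covDerivAlong_eq_vertProj_add_horProj hQ hγ' hW]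

/-- The horizontal part of the acceleration of a curve. -/
theorem horProj_covDerivAlong_velocity
    (hQ : MDifferentiableAt I 𝓘(ℝ, E →L[ℝ] E) (horCoord I' g φ (γ t)) (γ t))
    (hγ : ContMDiffAt 𝓘(ℝ, ℝ) I ∞ γ t) :
    horProj I' g φ (γ t) (g.covDerivAlong γ (velocity I γ) t)
      = oneillT I' g φ (γ t) (vertProj I' g φ (γ t) (velocity I γ t))
          (vertProj I' g φ (γ t) (velocity I γ t))
        + oneillA I' g φ (γ t) (horProj I' g φ (γ t) (velocity I γ t))
          (vertProj I' g φ (γ t) (velocity I γ t))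
        + horProj I' g φ (γ t)
          (g.covDerivAlong γ (fun s => horProj I' g φ (γ s) (velocity I γ s)) t) := by
  have hγ' := hγ.mdifferentiableAt (by simp)
  have hW := diffAlongAt_velocity hγ
  rw [oneillT_add_oneillA, ← horProj_covDerivAlong_vertProj hQ hγ' hW, ← map_add,
    ← covDerivAlong_eq_vertProj_add_horProj hQ hγ' hW]

end Curve
end Generic

/-! ### Tangent vectors of a product -/

section Product

variable {E₁ : Type*} [NormedAddCommGroup E₁] [NormedSpace ℝ E₁] [FiniteDimensional ℝ E₁]
  {H₁ : Type*} [TopologicalSpace H₁] {I₁ : ModelWithCorners ℝ E₁ H₁}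
  {M₁ : Type*} [TopologicalSpace M₁] [ChartedSpace H₁ M₁] [IsManifold I₁ ∞ M₁]
  {E₂ : Type*} [NormedAddCommGroup E₂] [NormedSpace ℝ E₂] [FiniteDimensional ℝ E₂]
  {H₂ : Type*} [TopologicalSpace H₂] {I₂ : ModelWithCorners ℝ E₂ H₂}
  {M₂ : Type*} [TopologicalSpace M₂] [ChartedSpace H₂ M₂] [IsManifold I₂ ∞ M₂]

section Tangent

omit [FiniteDimensional ℝ E₁] [FiniteDimensional ℝ E₂]

section

omit [IsManifold I₁ ∞ M₁] [IsManifold I₂ ∞ M₂]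

theorem dfst_apply (x : M₁ × M₂) (v : TangentSpace (I₁.prod I₂) x) :
    dfst I₁ I₂ x v = v.1 := by
  rw [dfst, mfderiv_fst]
  rfl

theorem dsnd_apply (x : M₁ × M₂) (v : TangentSpace (I₁.prod I₂) x) :
    dsnd I₁ I₂ x v = v.2 := by
  rw [dsnd, mfderiv_snd]
  rfl

theorem tangent_prod_ext {x : M₁ × M₂} {v w : TangentSpace (I₁.prod I₂) x}
    (h₁ : dfst I₁ I₂ x v = dfst I₁ I₂ x w) (h₂ : dsnd I₁ I₂ x v = dsnd I₁ I₂ x w) : v = w := by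
  rw [dfst_apply, dfst_apply] at h₁
  rw [dsnd_apply, dsnd_apply] at h₂
  exact Prod.ext h₁ h₂

theorem dfst_lift₁ (x : M₁ × M₂) (v : TangentSpace I₁ x.1) :
    dfst I₁ I₂ x (lift₁ I₁ I₂ x v) = v := by
  rw [dfst_apply, lift₁, mfderiv_prod_left]
  rfl

theorem dsnd_lift₁ (x : M₁ × M₂) (v : TangentSpace I₁ x.1) :
    dsnd I₁ I₂ x (lift₁ I₁ I₂ x v) = 0 := by
  rw [dsnd_apply, lift₁, mfderiv_prod_left]
  rfl

theorem dfst_lift₂ (x : M₁ × M₂) (v : TangentSpace I₂ x.2) :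
    dfst I₁ I₂ x (lift₂ I₁ I₂ x v) = 0 := by
  rw [dfst_apply, lift₂, mfderiv_prod_right]
  rfl

theorem dsnd_lift₂ (x : M₁ × M₂) (v : TangentSpace I₂ x.2) :
    dsnd I₁ I₂ x (lift₂ I₁ I₂ x v) = v := by
  rw [dsnd_apply, lift₂, mfderiv_prod_right]
  rfl

theorem lift₁_dfst_add_lift₂_dsnd (x : M₁ × M₂) (v : TangentSpace (I₁.prod I₂) x) :
    lift₁ I₁ I₂ x (dfst I₁ I₂ x v) + lift₂ I₁ I₂ x (dsnd I₁ I₂ x v) = v := by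
  refine tangent_prod_ext ?_ ?_
  · rw [map_add, dfst_lift₁, dfst_lift₂, add_zero]
  · rw [map_add, dsnd_lift₁, dsnd_lift₂, zero_add]

section

variable {γ₁ : ℝ → M₁} {γ₂ : ℝ → M₂} {t : ℝ}

theorem dfst_velocity (h₁ : MDifferentiableAt 𝓘(ℝ, ℝ) I₁ γ₁ t)
    (h₂ : MDifferentiableAt 𝓘(ℝ, ℝ) I₂ γ₂ t) :
    dfst I₁ I₂ (γ₁ t, γ₂ t) (velocity (I₁.prod I₂) (fun s => (γ₁ s, γ₂ s)) t)
      = velocity I₁ γ₁ t := by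
  rw [dfst_apply, velocity, mfderiv_prodMk h₁ h₂]
  rfl

theorem dsnd_velocity (h₁ : MDifferentiableAt 𝓘(ℝ, ℝ) I₁ γ₁ t)
    (h₂ : MDifferentiableAt 𝓘(ℝ, ℝ) I₂ γ₂ t) :
    dsnd I₁ I₂ (γ₁ t, γ₂ t) (velocity (I₁.prod I₂) (fun s => (γ₁ s, γ₂ s)) t)
      = velocity I₂ γ₂ t := by
  rw [dsnd_apply, velocity, mfderiv_prodMk h₁ h₂]
  rfl

end

theorem mvfderiv_comp_fst {k : M₁ → ℝ} {x : M₁ × M₂} (hk : MDifferentiableAt I₁ 𝓘(ℝ, ℝ) k x.1)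
    (u : TangentSpace (I₁.prod I₂) x) :
    mvfderiv (I₁.prod I₂) (fun y : M₁ × M₂ => k y.1) x u = mvfderiv I₁ k x.1 (dfst I₁ I₂ x u) :=
  mvfderiv_comp_apply x (f := Prod.fst) (g := k) hk mdifferentiableAt_fst u

theorem mvfderiv_comp_snd {k : M₂ → ℝ} {x : M₁ × M₂} (hk : MDifferentiableAt I₂ 𝓘(ℝ, ℝ) k x.2)
    (u : TangentSpace (I₁.prod I₂) x) :
    mvfderiv (I₁.prod I₂) (fun y : M₁ × M₂ => k y.2) x u = mvfderiv I₂ k x.2 (dsnd I₁ I₂ x u) :=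
  mvfderiv_comp_apply x (f := Prod.snd) (g := k) hk mdifferentiableAt_snd u

end

end Tangent

theorem lift_coordField_self (x : M₁ × M₂) (a : E₁ × E₂) :
    coordField (I₁.prod I₂) x x a
      = lift₁ I₁ I₂ x (coordField I₁ x.1 x.1 a.1) + lift₂ I₁ I₂ x (coordField I₂ x.2 x.2 a.2) := by
  rw [← dfst_coordField (I₂ := I₂) (mem_chart_source (ModelProd H₁ H₂) x) a,
    ← dsnd_coordField (I₁ := I₁) (mem_chart_source (ModelProd H₁ H₂) x) a,
    lift₁_dfst_add_lift₂_dsnd]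

theorem coordComp_prod {x y : M₁ × M₂} (hy : y ∈ (chartAt (ModelProd H₁ H₂) x).source)
    (v : TangentSpace (I₁.prod I₂) y) :
    coordComp (I₁.prod I₂) x y v
      = (coordComp I₁ x.1 y.1 (dfst I₁ I₂ y v), coordComp I₂ x.2 y.2 (dsnd I₁ I₂ y v)) := by
  have hy' : y.1 ∈ (chartAt H₁ x.1).source ∧ y.2 ∈ (chartAt H₂ x.2).source := by
    simpa using hy
  conv_rhs => rw [← coordField_coordComp hy v]
  rw [dfst_coordField hy, dsnd_coordField hy, coordComp_coordField hy'.1,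
    coordComp_coordField hy'.2]

/-! ### The Levi-Civita connection of a warped product -/

namespace WarpedProduct

variable (W : WarpedProduct I₁ M₁ I₂ M₂)

theorem inner_apply (x : M₁ × M₂) (v w : TangentSpace (I₁.prod I₂) x) :
    W.metric.inner x v w = W.g₁.inner x.1 (dfst I₁ I₂ x v) (dfst I₁ I₂ x w)
      + W.f x.1 ^ 2 * W.g₂.inner x.2 (dsnd I₁ I₂ x v) (dsnd I₁ I₂ x w) := rfl

omit [FiniteDimensional ℝ E₁] [FiniteDimensional ℝ E₂] in
theorem mdifferentiableAt_f (x : M₁) : MDifferentiableAt I₁ 𝓘(ℝ, ℝ) W.f x :=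
  (W.f_smooth x).mdifferentiableAt (by simp)

theorem coord_metric {x y : M₁ × M₂} (hy : y ∈ (chartAt (ModelProd H₁ H₂) x).source)
    (a b : E₁ × E₂) :
    W.metric.coord x y a b = W.g₁.coord x.1 y.1 a.1 b.1
      + W.f y.1 * W.f y.1 * W.g₂.coord x.2 y.2 a.2 b.2 := by
  rw [Metric.coord_apply, Metric.coord_apply, Metric.coord_apply, W.inner_apply,
    dfst_coordField hy, dfst_coordField hy, dsnd_coordField hy, dsnd_coordField hy, pow_two]

/-- The Leibniz rule for `g₁ + f² g₂`, in product charts. -/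
theorem coordDeriv_metric (x : M₁ × M₂) (u v w : TangentSpace (I₁.prod I₂) x) :
    W.metric.coordDeriv x u (coordComp (I₁.prod I₂) x x v) (coordComp (I₁.prod I₂) x x w)
      = W.g₁.coordDeriv x.1 (dfst I₁ I₂ x u) (coordComp I₁ x.1 x.1 (dfst I₁ I₂ x v))
          (coordComp I₁ x.1 x.1 (dfst I₁ I₂ x w))
        + W.f x.1 ^ 2 * W.g₂.coordDeriv x.2 (dsnd I₁ I₂ x u)
          (coordComp I₂ x.2 x.2 (dsnd I₁ I₂ x v)) (coordComp I₂ x.2 x.2 (dsnd I₁ I₂ x w))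
        + 2 * W.f x.1 * mvfderiv I₁ W.f x.1 (dfst I₁ I₂ x u)
          * W.g₂.inner x.2 (dsnd I₁ I₂ x v) (dsnd I₁ I₂ x w) := by
  have hx := mem_chart_source (ModelProd H₁ H₂) x
  have h1 : ∀ a b, MDifferentiableAt (I₁.prod I₂) 𝓘(ℝ, ℝ)
      (fun y : M₁ × M₂ => W.g₁.coord x.1 y.1 a b) x := fun a b => (W.g₁.mdifferentiableAt_coord_apply x.1 a b).comp x
    (mdifferentiableAt_fst (I := I₁) (I' := I₂))
  have h2 : ∀ a b, MDifferentiableAt (I₁.prod I₂) 𝓘(ℝ, ℝ)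
      (fun y : M₁ × M₂ => W.g₂.coord x.2 y.2 a b) x := fun a b => (W.g₂.mdifferentiableAt_coord_apply x.2 a b).comp x
    (mdifferentiableAt_snd (I := I₁) (I' := I₂))
  have hf : MDifferentiableAt (I₁.prod I₂) 𝓘(ℝ, ℝ) (fun y : M₁ × M₂ => W.f y.1) x :=
    (W.mdifferentiableAt_f x.1).comp x (mdifferentiableAt_fst (I := I₁) (I' := I₂))
  have hff : MDifferentiableAt (I₁.prod I₂) 𝓘(ℝ, ℝ) (fun y : M₁ × M₂ => W.f y.1 * W.f y.1) x :=
    hf.mul hf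
  have hm : ∀ a b, MDifferentiableAt (I₁.prod I₂) 𝓘(ℝ, ℝ)
      (fun y : M₁ × M₂ => W.f y.1 * W.f y.1 * W.g₂.coord x.2 y.2 a b) x := fun a b =>
    hff.mul (h2 a b)
  have e : ∀ a b, (fun y => W.metric.coord x y a b) =ᶠ[𝓝 x] (fun y => W.g₁.coord x.1 y.1 a.1 b.1
      + W.f y.1 * W.f y.1 * W.g₂.coord x.2 y.2 a.2 b.2) := fun a b => by
    filter_upwards [eventually_mem_chartAt_source (H := ModelProd H₁ H₂) x] with y hy
    exact W.coord_metric hy a b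
  rw [Metric.coordDeriv_apply, mvfderiv_congr (e _ _),
    mvfderiv_fun_add (h1 _ _) (hm _ _), mvfderiv_fun_mul hff (h2 _ _), mvfderiv_fun_mul hf hf]
  simp only [add_apply, smul_apply, smul_eq_mul]
  rw [mvfderiv_comp_fst (W.mdifferentiableAt_f x.1),
    mvfderiv_comp_fst (k := fun y => W.g₁.coord x.1 y _ _)
      (W.g₁.mdifferentiableAt_coord_apply x.1 _ _),
    mvfderiv_comp_snd (k := fun y => W.g₂.coord x.2 y _ _)
      (W.g₂.mdifferentiableAt_coord_apply x.2 _ _),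
    coordComp_prod hx, coordComp_prod hx, Metric.coord_coordComp, ← Metric.coordDeriv_apply,
    ← Metric.coordDeriv_apply]
  ring

theorem christoffelForm_metric_self (x : M₁ × M₂) (u w : TangentSpace (I₁.prod I₂) x) :
    W.metric.christoffelForm x u u w
      = W.g₁.christoffelForm x.1 (dfst I₁ I₂ x u) (dfst I₁ I₂ x u) (dfst I₁ I₂ x w)
        + W.f x.1 ^ 2
          * W.g₂.christoffelForm x.2 (dsnd I₁ I₂ x u) (dsnd I₁ I₂ x u) (dsnd I₁ I₂ x w)
        + 2 * W.f x.1 * mvfderiv I₁ W.f x.1 (dfst I₁ I₂ x u)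
          * W.g₂.inner x.2 (dsnd I₁ I₂ x u) (dsnd I₁ I₂ x w)
        - W.f x.1 * mvfderiv I₁ W.f x.1 (dfst I₁ I₂ x w)
          * W.g₂.inner x.2 (dsnd I₁ I₂ x u) (dsnd I₁ I₂ x u) := by
  simp only [Metric.christoffelForm, LinearMap.coe_mk, AddHom.coe_mk, coordDeriv_metric]
  ring

theorem inner_gradLog (x : M₁ × M₂) (w : TangentSpace (I₁.prod I₂) x) :
    W.metric.inner x (W.gradLog x) w
      = mvfderiv I₁ W.f x.1 (dfst I₁ I₂ x w) / W.f x.1 := by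
  have hf := W.mdifferentiableAt_f x.1
  have hlog : HasDerivAt Real.log (W.f x.1)⁻¹ (W.f x.1) :=
    Real.hasDerivAt_log (W.f_pos x.1).ne'
  have hc : MDifferentiableAt I₁ 𝓘(ℝ, ℝ) (fun y => Real.log (W.f y)) x.1 :=
    hlog.differentiableAt.comp_mdifferentiableAt hf
  refine (W.metric.inner_sharp x _ w).trans ?_
  refine (mvfderiv_comp_fst hc w).trans ?_
  have := mvfderiv_comp_apply (I := 𝓘(ℝ, ℝ)) (g := Real.log) (f := W.f) x.1
    hlog.differentiableAt.mdifferentiableAt hf (dfst I₁ I₂ x w)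
  refine this.trans ?_
  have h2 : (mvfderiv 𝓘(ℝ, ℝ) Real.log (W.f x.1) : ℝ →L[ℝ] ℝ) = fderiv ℝ Real.log (W.f x.1) :=
    mfderiv_eq_fderiv
  refine (congrArg (fun L : ℝ →L[ℝ] ℝ => L (mvfderiv I₁ W.f x.1 (dfst I₁ I₂ x w))) h2).trans ?_
  rw [hlog.hasFDerivAt.fderiv, div_eq_mul_inv]
  rfl

/-- The Christoffel term of the warped product metric on the diagonal. -/
theorem christoffel_metric_self (x : M₁ × M₂) (u : TangentSpace (I₁.prod I₂) x) :
    W.metric.christoffel x u u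
      = lift₁ I₁ I₂ x (W.g₁.christoffel x.1 (dfst I₁ I₂ x u) (dfst I₁ I₂ x u))
        + lift₂ I₁ I₂ x (W.g₂.christoffel x.2 (dsnd I₁ I₂ x u) (dsnd I₁ I₂ x u))
        + (2 * (mvfderiv I₁ W.f x.1 (dfst I₁ I₂ x u) / W.f x.1)) •
          lift₂ I₁ I₂ x (dsnd I₁ I₂ x u)
        - W.metric.inner x (lift₂ I₁ I₂ x (dsnd I₁ I₂ x u)) (lift₂ I₁ I₂ x (dsnd I₁ I₂ x u)) •
          W.gradLog x := by
  -- Both sides are compared after pairing with an arbitrary vector, which removes `sharp`.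
  refine W.metric.ext_inner fun w => ?_
  have hf := (W.f_pos x.1).ne'
  rw [Metric.inner_christoffel, christoffelForm_metric_self]
  simp only [map_add, map_sub, map_smul, add_apply, sub_apply, smul_apply, smul_eq_mul,
    inner_gradLog]
  simp only [inner_apply, dfst_lift₁, dfst_lift₂, dsnd_lift₁, dsnd_lift₂, map_zero, zero_apply,
    Metric.inner_christoffel]
  field_simp
  ring

/-- The acceleration of a curve in a warped product:
`∇_γ̇ γ̇ = ∇¹_γ̇₁ γ̇₁ + ∇²_γ̇₂ γ̇₂ + 2 (γ̇₁(f) / f) γ̇₂ - g(γ̇₂, γ̇₂) ∇ ln f`. -/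
theorem covDerivAlong_velocity {γ₁ : ℝ → M₁} {γ₂ : ℝ → M₂} {t : ℝ}
    (h₁ : ContMDiffAt 𝓘(ℝ, ℝ) I₁ ∞ γ₁ t) (h₂ : ContMDiffAt 𝓘(ℝ, ℝ) I₂ ∞ γ₂ t) :
    W.metric.covDerivAlong (fun s => (γ₁ s, γ₂ s))
        (velocity (I₁.prod I₂) (fun s => (γ₁ s, γ₂ s))) t
      = lift₁ I₁ I₂ (γ₁ t, γ₂ t) (W.g₁.covDerivAlong γ₁ (velocity I₁ γ₁) t)
        + lift₂ I₁ I₂ (γ₁ t, γ₂ t) (W.g₂.covDerivAlong γ₂ (velocity I₂ γ₂) t)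
        + (2 * (mvfderiv I₁ W.f (γ₁ t) (velocity I₁ γ₁ t) / W.f (γ₁ t))) •
          lift₂ I₁ I₂ (γ₁ t, γ₂ t) (velocity I₂ γ₂ t)
        - W.metric.inner (γ₁ t, γ₂ t) (lift₂ I₁ I₂ (γ₁ t, γ₂ t) (velocity I₂ γ₂ t))
            (lift₂ I₁ I₂ (γ₁ t, γ₂ t) (velocity I₂ γ₂ t)) • W.gradLog (γ₁ t, γ₂ t) := by
  -- The velocity of `(γ₁, γ₂)` splits only where both curves are differentiable.
  have e : (fun s => coordComp (I₁.prod I₂) (γ₁ t, γ₂ t) (γ₁ s, γ₂ s)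
        (velocity (I₁.prod I₂) (fun s => (γ₁ s, γ₂ s)) s))
      =ᶠ[𝓝 t] fun s => (coordComp I₁ (γ₁ t) (γ₁ s) (velocity I₁ γ₁ s),
        coordComp I₂ (γ₂ t) (γ₂ s) (velocity I₂ γ₂ s)) := by
    have hc : ContinuousAt (fun s => (γ₁ s, γ₂ s)) t := h₁.continuousAt.prodMk h₂.continuousAt
    filter_upwards [hc.eventually (eventually_mem_chartAt_source (H := ModelProd H₁ H₂) _),
      (contMDiffAt_iff_contMDiffAt_nhds (n := 1) (by simp)).1 (h₁.of_le (by simp)),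
      (contMDiffAt_iff_contMDiffAt_nhds (n := 1) (by simp)).1 (h₂.of_le (by simp))] with s hs hs₁ hs₂
    rw [coordComp_prod hs, dfst_velocity (hs₁.mdifferentiableAt one_ne_zero)
      (hs₂.mdifferentiableAt one_ne_zero), dsnd_velocity (hs₁.mdifferentiableAt one_ne_zero)
      (hs₂.mdifferentiableAt one_ne_zero)]
  have hd := (diffAlongAt_velocity h₁).hasDerivAt.prodMk (diffAlongAt_velocity h₂).hasDerivAt
  have h₁' := h₁.mdifferentiableAt (by simp)
  have h₂' := h₂.mdifferentiableAt (by simp)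
  unfold Metric.covDerivAlong
  rw [e.deriv_eq, hd.deriv, W.christoffel_metric_self, lift_coordField_self,
    dfst_velocity h₁' h₂', dsnd_velocity h₁' h₂', map_add, map_add]
  abel

end WarpedProduct

variable {F₁ : Type*} [NormedAddCommGroup F₁] [NormedSpace ℝ F₁]
  {K₁ : Type*} [TopologicalSpace K₁] {J₁ : ModelWithCorners ℝ F₁ K₁}
  {N₁ : Type*} [TopologicalSpace N₁] [ChartedSpace K₁ N₁] [IsManifold J₁ ∞ N₁]
  {F₂ : Type*} [NormedAddCommGroup F₂] [NormedSpace ℝ F₂]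
  {K₂ : Type*} [TopologicalSpace K₂] {J₂ : ModelWithCorners ℝ F₂ K₂}
  {N₂ : Type*} [TopologicalSpace N₂] [ChartedSpace K₂ N₂] [IsManifold J₂ ∞ N₂]

/-! ### Products of Riemannian maps -/

namespace IsRiemannianWarpedProductMap

variable {W : WarpedProduct I₁ M₁ I₂ M₂} {Z : WarpedProduct J₁ N₁ J₂ N₂} {φ₁ : M₁ → N₁}
  {φ₂ : M₂ → N₂} {φ : M₁ × M₂ → N₁ × N₂}

omit [FiniteDimensional ℝ E₁] [FiniteDimensional ℝ E₂] in
theorem mem_vertical (hφ : IsRiemannianWarpedProductMap W Z φ₁ φ₂ φ) {x : M₁ × M₂}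
    {v : TangentSpace (I₁.prod I₂) x} :
    v ∈ vertical (I₁.prod I₂) (J₁.prod J₂) φ x
      ↔ dfst I₁ I₂ x v ∈ vertical I₁ J₁ φ₁ x.1 ∧ dsnd I₁ I₂ x v ∈ vertical I₂ J₂ φ₂ x.2 := by
  obtain rfl : φ = Prod.map φ₁ φ₂ := funext hφ.eq_prod
  have h := mfderiv_prodMap ((hφ.fst.contMDiff x.1).mdifferentiableAt (by simp))
    ((hφ.snd.contMDiff x.2).mdifferentiableAt (by simp))
  unfold vertical
  rw [LinearMap.mem_ker, LinearMap.mem_ker, LinearMap.mem_ker, dfst_apply, dsnd_apply]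
  exact (Eq.congr (congrArg (fun L : E₁ × E₂ →L[ℝ] F₁ × F₂ => L v) h) rfl).trans
    (Prod.mk_inj (α := F₁) (β := F₂))

theorem mem_horizontal (hφ : IsRiemannianWarpedProductMap W Z φ₁ φ₂ φ) {x : M₁ × M₂}
    {v : TangentSpace (I₁.prod I₂) x} (h₁ : dfst I₁ I₂ x v ∈ horizontal J₁ W.g₁ φ₁ x.1)
    (h₂ : dsnd I₁ I₂ x v ∈ horizontal J₂ W.g₂ φ₂ x.2) :
    v ∈ horizontal (J₁.prod J₂) W.metric φ x := by
  refine LinearMap.BilinForm.mem_orthogonal_iff.2 fun w hw => ?_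
  rw [hφ.mem_vertical] at hw
  change W.metric.inner x w v = 0
  rw [W.inner_apply, inner_vertical_horizontal hw.1 h₁, inner_vertical_horizontal hw.2 h₂,
    mul_zero, add_zero]

theorem vertProj_lift (hφ : IsRiemannianWarpedProductMap W Z φ₁ φ₂ φ) (x : M₁ × M₂)
    (v : TangentSpace I₁ x.1) (w : TangentSpace I₂ x.2) :
    vertProj (J₁.prod J₂) W.metric φ x (lift₁ I₁ I₂ x v + lift₂ I₁ I₂ x w)
      = lift₁ I₁ I₂ x (vertProj J₁ W.g₁ φ₁ x.1 v) + lift₂ I₁ I₂ x (vertProj J₂ W.g₂ φ₂ x.2 w) := by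
  have e : lift₁ I₁ I₂ x v + lift₂ I₁ I₂ x w
      = (lift₁ I₁ I₂ x (vertProj J₁ W.g₁ φ₁ x.1 v) + lift₂ I₁ I₂ x (vertProj J₂ W.g₂ φ₂ x.2 w))
        + (lift₁ I₁ I₂ x (horProj J₁ W.g₁ φ₁ x.1 v)
          + lift₂ I₁ I₂ x (horProj J₂ W.g₂ φ₂ x.2 w)) := by
    conv_lhs => rw [← vertProj_add_horProj (I' := J₁) W.g₁ φ₁ x.1 v,
      ← vertProj_add_horProj (I' := J₂) W.g₂ φ₂ x.2 w, map_add, map_add]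
    abel
  have hv : lift₁ I₁ I₂ x (vertProj J₁ W.g₁ φ₁ x.1 v) + lift₂ I₁ I₂ x (vertProj J₂ W.g₂ φ₂ x.2 w)
      ∈ vertical (I₁.prod I₂) (J₁.prod J₂) φ x := by
    refine hφ.mem_vertical.2 ⟨?_, ?_⟩
    · rw [map_add, dfst_lift₁, dfst_lift₂, add_zero]
      exact vertProj_mem _ _ _ _
    · rw [map_add, dsnd_lift₁, dsnd_lift₂, zero_add]
      exact vertProj_mem _ _ _ _
  have hh : lift₁ I₁ I₂ x (horProj J₁ W.g₁ φ₁ x.1 v) + lift₂ I₁ I₂ x (horProj J₂ W.g₂ φ₂ x.2 w)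
      ∈ horizontal (J₁.prod J₂) W.metric φ x := by
    refine hφ.mem_horizontal ?_ ?_
    · rw [map_add, dfst_lift₁, dfst_lift₂, add_zero]
      exact horProj_mem _ _ _ _
    · rw [map_add, dsnd_lift₁, dsnd_lift₂, zero_add]
      exact horProj_mem _ _ _ _
  rw [e, map_add, vertProj_of_mem_vertical hv, vertProj_of_mem_horizontal hh, add_zero]

theorem vertProj_lift₁ (hφ : IsRiemannianWarpedProductMap W Z φ₁ φ₂ φ) (x : M₁ × M₂)
    (v : TangentSpace I₁ x.1) : vertProj (J₁.prod J₂) W.metric φ x (lift₁ I₁ I₂ x v)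
      = lift₁ I₁ I₂ x (vertProj J₁ W.g₁ φ₁ x.1 v) := by
  simpa only [map_zero, add_zero] using hφ.vertProj_lift x v 0

theorem vertProj_lift₂ (hφ : IsRiemannianWarpedProductMap W Z φ₁ φ₂ φ) (x : M₁ × M₂)
    (w : TangentSpace I₂ x.2) : vertProj (J₁.prod J₂) W.metric φ x (lift₂ I₁ I₂ x w)
      = lift₂ I₁ I₂ x (vertProj J₂ W.g₂ φ₂ x.2 w) := by
  simpa only [map_zero, zero_add] using hφ.vertProj_lift x 0 w

theorem horProj_lift₁ (hφ : IsRiemannianWarpedProductMap W Z φ₁ φ₂ φ) (x : M₁ × M₂)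
    (v : TangentSpace I₁ x.1) : horProj (J₁.prod J₂) W.metric φ x (lift₁ I₁ I₂ x v)
      = lift₁ I₁ I₂ x (horProj J₁ W.g₁ φ₁ x.1 v) := by
  have h := vertProj_add_horProj (I' := J₁.prod J₂) W.metric φ x (lift₁ I₁ I₂ x v)
  rw [hφ.vertProj_lift₁] at h
  rw [eq_sub_of_add_eq' h, ← map_sub, ← eq_sub_of_add_eq' (vertProj_add_horProj W.g₁ φ₁ x.1 v)]

theorem horProj_lift₂ (hφ : IsRiemannianWarpedProductMap W Z φ₁ φ₂ φ) (x : M₁ × M₂)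
    (w : TangentSpace I₂ x.2) : horProj (J₁.prod J₂) W.metric φ x (lift₂ I₁ I₂ x w)
      = lift₂ I₁ I₂ x (horProj J₂ W.g₂ φ₂ x.2 w) := by
  have h := vertProj_add_horProj (I' := J₁.prod J₂) W.metric φ x (lift₂ I₁ I₂ x w)
  rw [hφ.vertProj_lift₂] at h
  rw [eq_sub_of_add_eq' h, ← map_sub, ← eq_sub_of_add_eq' (vertProj_add_horProj W.g₂ φ₂ x.2 w)]

theorem dfst_vertProj (hφ : IsRiemannianWarpedProductMap W Z φ₁ φ₂ φ) (x : M₁ × M₂)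
    (v : TangentSpace (I₁.prod I₂) x) :
    dfst I₁ I₂ x (vertProj (J₁.prod J₂) W.metric φ x v)
      = vertProj J₁ W.g₁ φ₁ x.1 (dfst I₁ I₂ x v) := by
  conv_lhs => rw [← lift₁_dfst_add_lift₂_dsnd x v, hφ.vertProj_lift, map_add, dfst_lift₁,
    dfst_lift₂, add_zero]

theorem dsnd_vertProj (hφ : IsRiemannianWarpedProductMap W Z φ₁ φ₂ φ) (x : M₁ × M₂)
    (v : TangentSpace (I₁.prod I₂) x) :
    dsnd I₁ I₂ x (vertProj (J₁.prod J₂) W.metric φ x v)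
      = vertProj J₂ W.g₂ φ₂ x.2 (dsnd I₁ I₂ x v) := by
  conv_lhs => rw [← lift₁_dfst_add_lift₂_dsnd x v, hφ.vertProj_lift, map_add, dsnd_lift₁,
    dsnd_lift₂, zero_add]

end IsRiemannianWarpedProductMap
end Product

/-! ### Acceleration of a curve in a warped product -/

namespace IsRiemannianWarpedProductMap

variable {E₁ : Type*} [NormedAddCommGroup E₁] [NormedSpace ℝ E₁] [FiniteDimensional ℝ E₁]
  {H₁ : Type*} [TopologicalSpace H₁] {I₁ : ModelWithCorners ℝ E₁ H₁}
  {M₁ : Type*} [TopologicalSpace M₁] [ChartedSpace H₁ M₁] [IsManifold I₁ ∞ M₁]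
  {E₂ : Type*} [NormedAddCommGroup E₂] [NormedSpace ℝ E₂] [FiniteDimensional ℝ E₂]
  {H₂ : Type*} [TopologicalSpace H₂] {I₂ : ModelWithCorners ℝ E₂ H₂}
  {M₂ : Type*} [TopologicalSpace M₂] [ChartedSpace H₂ M₂] [IsManifold I₂ ∞ M₂]
  {F₁ : Type*} [NormedAddCommGroup F₁] [NormedSpace ℝ F₁]
  {K₁ : Type*} [TopologicalSpace K₁] {J₁ : ModelWithCorners ℝ F₁ K₁}
  {N₁ : Type*} [TopologicalSpace N₁] [ChartedSpace K₁ N₁] [IsManifold J₁ ∞ N₁]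
  {F₂ : Type*} [NormedAddCommGroup F₂] [NormedSpace ℝ F₂]
  {K₂ : Type*} [TopologicalSpace K₂] {J₂ : ModelWithCorners ℝ F₂ K₂}
  {N₂ : Type*} [TopologicalSpace N₂] [ChartedSpace K₂ N₂] [IsManifold J₂ ∞ N₂]
  {W : WarpedProduct I₁ M₁ I₂ M₂} {Z : WarpedProduct J₁ N₁ J₂ N₂} {φ₁ : M₁ → N₁}
  {φ₂ : M₂ → N₂} {φ : M₁ × M₂ → N₁ × N₂} {γ₁ : ℝ → M₁} {γ₂ : ℝ → M₂} {t : ℝ}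

/-- Pythagoras for the lift of a tangent vector of `M₂`. -/
theorem inner_lift₂_self (x : M₁ × M₂) (v : TangentSpace I₂ x.2) :
    W.metric.inner x (lift₂ I₁ I₂ x v) (lift₂ I₁ I₂ x v)
      = W.metric.inner x (lift₂ I₁ I₂ x (vertProj J₂ W.g₂ φ₂ x.2 v))
          (lift₂ I₁ I₂ x (vertProj J₂ W.g₂ φ₂ x.2 v))
        + W.metric.inner x (lift₂ I₁ I₂ x (horProj J₂ W.g₂ φ₂ x.2 v))
          (lift₂ I₁ I₂ x (horProj J₂ W.g₂ φ₂ x.2 v)) := by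
  simp only [W.inner_apply, dfst_lift₂, dsnd_lift₂, map_zero]
  rw [inner_eq_vertProj_add_horProj (I' := J₂) (φ := φ₂) v]
  ring

/-- The vertical part of the acceleration of a curve in a warped product. -/
theorem vertProj_acceleration (hφ : IsRiemannianWarpedProductMap W Z φ₁ φ₂ φ)
    (h₁ : ContMDiffAt 𝓘(ℝ, ℝ) I₁ ∞ γ₁ t) (h₂ : ContMDiffAt 𝓘(ℝ, ℝ) I₂ ∞ γ₂ t) :
    let V₁ := fun t => vertProj J₁ W.g₁ φ₁ (γ₁ t)
    let H₁ := fun t => horProj J₁ W.g₁ φ₁ (γ₁ t)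
    let V₂ := fun t => vertProj J₂ W.g₂ φ₂ (γ₂ t)
    let H₂ := fun t => horProj J₂ W.g₂ φ₂ (γ₂ t)
    let V := vertProj (J₁.prod J₂) W.metric φ (γ₁ t, γ₂ t)
    let U₁ := fun t => V₁ t (velocity I₁ γ₁ t)
    let Y₁ := fun t => H₁ t (velocity I₁ γ₁ t)
    let U₂ := fun t => V₂ t (velocity I₂ γ₂ t)
    let Y₂ := fun t => H₂ t (velocity I₂ γ₂ t)
    let T₁ := oneillT J₁ W.g₁ φ₁ (γ₁ t)
    let A₁ := oneillA J₁ W.g₁ φ₁ (γ₁ t)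
    let T₂ := oneillT J₂ W.g₂ φ₂ (γ₂ t)
    let A₂ := oneillA J₂ W.g₂ φ₂ (γ₂ t)
    let ℓ₁ := lift₁ I₁ I₂ (γ₁ t, γ₂ t)
    let ℓ₂ := lift₂ I₁ I₂ (γ₁ t, γ₂ t)
    let df := fun v => mvfderiv I₁ W.f (γ₁ t) v / W.f (γ₁ t)
    let q := fun v => W.metric.inner (γ₁ t, γ₂ t) (ℓ₂ v) (ℓ₂ v)
    let G := W.gradLog (γ₁ t, γ₂ t)
    V (W.metric.covDerivAlong (fun s => (γ₁ s, γ₂ s))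
        (velocity (I₁.prod I₂) (fun s => (γ₁ s, γ₂ s))) t)
      = ℓ₁ (V₁ t (W.g₁.covDerivAlong γ₁ U₁ t)) + ℓ₁ (T₁ (U₁ t) (Y₁ t)) + ℓ₁ (A₁ (Y₁ t) (Y₁ t))
        + (2 * df (U₁ t)) • ℓ₂ (U₂ t) + (2 * df (Y₁ t)) • ℓ₂ (U₂ t)
        - q (U₂ t) • V G - q (Y₂ t) • V G
        + ℓ₂ (V₂ t (W.g₂.covDerivAlong γ₂ U₂ t)) + ℓ₂ (T₂ (U₂ t) (Y₂ t))
        + ℓ₂ (A₂ (Y₂ t) (Y₂ t)) := by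
  intro V₁ H₁ V₂ H₂ V U₁ Y₁ U₂ Y₂ T₁ A₁ T₂ A₂ ℓ₁ ℓ₂ df q G
  have e₁ := vertProj_covDerivAlong_velocity (hφ.fst.mdifferentiableAt_horCoord (γ₁ t)) h₁
  have e₂ := vertProj_covDerivAlong_velocity (hφ.snd.mdifferentiableAt_horCoord (γ₂ t)) h₂
  have hdf : df (velocity I₁ γ₁ t) = df (U₁ t) + df (Y₁ t) := by
    simp only [df, U₁, Y₁, V₁, H₁]
    rw [← add_div, ← map_add, vertProj_add_horProj]
  have hq : q (velocity I₂ γ₂ t) = q (U₂ t) + q (Y₂ t) := inner_lift₂_self (γ₁ t, γ₂ t) _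
  rw [W.covDerivAlong_velocity h₁ h₂]
  change V (ℓ₁ _ + ℓ₂ _ + (2 * df (velocity I₁ γ₁ t)) • ℓ₂ _ - q (velocity I₂ γ₂ t) • G) = _
  have l₁ : ∀ v, V (ℓ₁ v) = ℓ₁ (V₁ t v) := hφ.vertProj_lift₁ (γ₁ t, γ₂ t)
  have l₂ : ∀ v, V (ℓ₂ v) = ℓ₂ (V₂ t v) := hφ.vertProj_lift₂ (γ₁ t, γ₂ t)
  rw [map_sub, map_add, map_add, map_smul, map_smul, hdf, hq, l₁, l₂, l₂]
  simp only [V₁, V₂]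
  rw [e₁, e₂]
  simp only [map_add]
  module

/-- The horizontal part of the acceleration of a curve in a warped product. -/
theorem horProj_acceleration (hφ : IsRiemannianWarpedProductMap W Z φ₁ φ₂ φ)
    (h₁ : ContMDiffAt 𝓘(ℝ, ℝ) I₁ ∞ γ₁ t) (h₂ : ContMDiffAt 𝓘(ℝ, ℝ) I₂ ∞ γ₂ t) :
    let V₁ := fun t => vertProj J₁ W.g₁ φ₁ (γ₁ t)
    let H₁ := fun t => horProj J₁ W.g₁ φ₁ (γ₁ t)
    let V₂ := fun t => vertProj J₂ W.g₂ φ₂ (γ₂ t)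
    let H₂ := fun t => horProj J₂ W.g₂ φ₂ (γ₂ t)
    let H := horProj (J₁.prod J₂) W.metric φ (γ₁ t, γ₂ t)
    let U₁ := fun t => V₁ t (velocity I₁ γ₁ t)
    let Y₁ := fun t => H₁ t (velocity I₁ γ₁ t)
    let U₂ := fun t => V₂ t (velocity I₂ γ₂ t)
    let Y₂ := fun t => H₂ t (velocity I₂ γ₂ t)
    let T₁ := oneillT J₁ W.g₁ φ₁ (γ₁ t)
    let A₁ := oneillA J₁ W.g₁ φ₁ (γ₁ t)
    let T₂ := oneillT J₂ W.g₂ φ₂ (γ₂ t)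
    let A₂ := oneillA J₂ W.g₂ φ₂ (γ₂ t)
    let ℓ₁ := lift₁ I₁ I₂ (γ₁ t, γ₂ t)
    let ℓ₂ := lift₂ I₁ I₂ (γ₁ t, γ₂ t)
    let df := fun v => mvfderiv I₁ W.f (γ₁ t) v / W.f (γ₁ t)
    let q := fun v => W.metric.inner (γ₁ t, γ₂ t) (ℓ₂ v) (ℓ₂ v)
    let G := W.gradLog (γ₁ t, γ₂ t)
    H (W.metric.covDerivAlong (fun s => (γ₁ s, γ₂ s))
        (velocity (I₁.prod I₂) (fun s => (γ₁ s, γ₂ s))) t)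
      = ℓ₁ (T₁ (U₁ t) (U₁ t)) + ℓ₂ (T₂ (U₂ t) (U₂ t)) + ℓ₁ (A₁ (Y₁ t) (U₁ t))
        + ℓ₂ (A₂ (Y₂ t) (U₂ t))
        + ℓ₁ (H₁ t (W.g₁.covDerivAlong γ₁ Y₁ t)) + ℓ₂ (H₂ t (W.g₂.covDerivAlong γ₂ Y₂ t))
        + (2 * df (U₁ t)) • ℓ₂ (Y₂ t) + (2 * df (Y₁ t)) • ℓ₂ (Y₂ t)
        - q (U₂ t) • H G - q (Y₂ t) • H G := by
  intro V₁ H₁ V₂ H₂ H U₁ Y₁ U₂ Y₂ T₁ A₁ T₂ A₂ ℓ₁ ℓ₂ df q G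
  have e₁ := horProj_covDerivAlong_velocity (hφ.fst.mdifferentiableAt_horCoord (γ₁ t)) h₁
  have e₂ := horProj_covDerivAlong_velocity (hφ.snd.mdifferentiableAt_horCoord (γ₂ t)) h₂
  have hdf : df (velocity I₁ γ₁ t) = df (U₁ t) + df (Y₁ t) := by
    simp only [df, U₁, Y₁, V₁, H₁]
    rw [← add_div, ← map_add, vertProj_add_horProj]
  have hq : q (velocity I₂ γ₂ t) = q (U₂ t) + q (Y₂ t) := inner_lift₂_self (γ₁ t, γ₂ t) _
  rw [W.covDerivAlong_velocity h₁ h₂]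
  change H (ℓ₁ _ + ℓ₂ _ + (2 * df (velocity I₁ γ₁ t)) • ℓ₂ _ - q (velocity I₂ γ₂ t) • G) = _
  have l₁ : ∀ v, H (ℓ₁ v) = ℓ₁ (H₁ t v) := hφ.horProj_lift₁ (γ₁ t, γ₂ t)
  have l₂ : ∀ v, H (ℓ₂ v) = ℓ₂ (H₂ t v) := hφ.horProj_lift₂ (γ₁ t, γ₂ t)
  rw [map_sub, map_add, map_add, map_smul, map_smul, hdf, hq, l₁, l₂, l₂]
  simp only [H₁, H₂]
  rw [e₁, e₂]
  simp only [map_add]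
  module

end IsRiemannianWarpedProductMap

end

end WarpedGeodesic

/-! ### Geodesics of a warped product -/

open WarpedGeodesic in
theorem mainTheorem2
    -- the manifolds `M₁`, `M₂`, `N₁`, `N₂`
    {E₁ : Type*} [NormedAddCommGroup E₁] [NormedSpace ℝ E₁] [FiniteDimensional ℝ E₁]
    {M₁ : Type*} [TopologicalSpace M₁] [ChartedSpace E₁ M₁] [IsManifold 𝓘(ℝ, E₁) ∞ M₁]
    {E₂ : Type*} [NormedAddCommGroup E₂] [NormedSpace ℝ E₂] [FiniteDimensional ℝ E₂]
    {M₂ : Type*} [TopologicalSpace M₂] [ChartedSpace E₂ M₂] [IsManifold 𝓘(ℝ, E₂) ∞ M₂]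
    {F₁ : Type*} [NormedAddCommGroup F₁] [NormedSpace ℝ F₁] [FiniteDimensional ℝ F₁]
    {N₁ : Type*} [TopologicalSpace N₁] [ChartedSpace F₁ N₁] [IsManifold 𝓘(ℝ, F₁) ∞ N₁]
    {F₂ : Type*} [NormedAddCommGroup F₂] [NormedSpace ℝ F₂] [FiniteDimensional ℝ F₂]
    {N₂ : Type*} [TopologicalSpace N₂] [ChartedSpace F₂ N₂] [IsManifold 𝓘(ℝ, F₂) ∞ N₂]
    -- the warped products `M₁ ×_f M₂` and `N₁ ×_ρ N₂`, and the map `φ = φ₁ × φ₂`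
    (M : WarpedProduct 𝓘(ℝ, E₁) M₁ 𝓘(ℝ, E₂) M₂) (N : WarpedProduct 𝓘(ℝ, F₁) N₁ 𝓘(ℝ, F₂) N₂)
    (φ₁ : M₁ → N₁) (φ₂ : M₂ → N₂) (φ : M₁ × M₂ → N₁ × N₂)
    (hφ : IsRiemannianWarpedProductMap M N φ₁ φ₂ φ)
    -- the regular curve `γ = (γ₁, γ₂)` on the open interval `J`
    (J : Set ℝ) (hJ : IsOpen J) (hJ' : J.OrdConnected)
    (γ₁ : ℝ → M₁) (γ₂ : ℝ → M₂)
    (hγ : IsRegularCurveOn (𝓘(ℝ, E₁).prod 𝓘(ℝ, E₂)) (fun t => (γ₁ t, γ₂ t)) J) :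
    let γ : ℝ → M₁ × M₂ := fun t => (γ₁ t, γ₂ t)
    let γ' := fun t => velocity (𝓘(ℝ, E₁).prod 𝓘(ℝ, E₂)) γ t
    -- the projections `𝒱ᵢ`, `ℋᵢ` at `γᵢ t` and the projections `𝒱`, `ℋ` at `γ t`
    let V₁ := fun t => vertProj 𝓘(ℝ, F₁) M.g₁ φ₁ (γ₁ t)
    let H₁ := fun t => horProj 𝓘(ℝ, F₁) M.g₁ φ₁ (γ₁ t)
    let V₂ := fun t => vertProj 𝓘(ℝ, F₂) M.g₂ φ₂ (γ₂ t)
    let H₂ := fun t => horProj 𝓘(ℝ, F₂) M.g₂ φ₂ (γ₂ t)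
    let V := fun t => vertProj (𝓘(ℝ, F₁).prod 𝓘(ℝ, F₂)) M.metric φ (γ t)
    let H := fun t => horProj (𝓘(ℝ, F₁).prod 𝓘(ℝ, F₂)) M.metric φ (γ t)
    -- the components `Uᵢ = 𝒱ᵢ γ̇ᵢ` and `Yᵢ = ℋᵢ γ̇ᵢ` of the velocity
    let U₁ := fun t => V₁ t (velocity 𝓘(ℝ, E₁) γ₁ t)
    let Y₁ := fun t => H₁ t (velocity 𝓘(ℝ, E₁) γ₁ t)
    let U₂ := fun t => V₂ t (velocity 𝓘(ℝ, E₂) γ₂ t)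
    let Y₂ := fun t => H₂ t (velocity 𝓘(ℝ, E₂) γ₂ t)
    -- the O'Neill tensors of `φᵢ` at `γᵢ t`
    let T₁ := fun t => oneillT 𝓘(ℝ, F₁) M.g₁ φ₁ (γ₁ t)
    let A₁ := fun t => oneillA 𝓘(ℝ, F₁) M.g₁ φ₁ (γ₁ t)
    let T₂ := fun t => oneillT 𝓘(ℝ, F₂) M.g₂ φ₂ (γ₂ t)
    let A₂ := fun t => oneillA 𝓘(ℝ, F₂) M.g₂ φ₂ (γ₂ t)
    -- the lifts to `γ t` of tangent vectors at `γᵢ t`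
    let ℓ₁ := fun t => lift₁ 𝓘(ℝ, E₁) 𝓘(ℝ, E₂) (γ t)
    let ℓ₂ := fun t => lift₂ 𝓘(ℝ, E₁) 𝓘(ℝ, E₂) (γ t)
    -- `v(f) / f` for a tangent vector `v` at `γ₁ t`
    let df := fun t (v : TangentSpace 𝓘(ℝ, E₁) (γ₁ t)) => mvfderiv 𝓘(ℝ, E₁) M.f (γ₁ t) v / M.f (γ₁ t)
    -- `g_M(v, v)` for (the lift of) a tangent vector `v` at `γ₂ t`
    let q := fun t (v : TangentSpace 𝓘(ℝ, E₂) (γ₂ t)) => M.metric.inner (γ t) (ℓ₂ t v) (ℓ₂ t v)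
    -- `∇^M ln f` at `γ t`
    let G := fun t => M.gradLog (γ t)
    -- (i) vertical velocity
    ((∀ t ∈ J, γ' t ∈ vertical (𝓘(ℝ, E₁).prod 𝓘(ℝ, E₂)) (𝓘(ℝ, F₁).prod 𝓘(ℝ, F₂)) φ (γ t)) →
      (IsGeodesicOn M.metric γ J ↔ ∀ t ∈ J,
        ℓ₁ t (V₁ t (M.g₁.covDerivAlong γ₁ U₁ t)) + (2 * df t (U₁ t)) • ℓ₂ t (U₂ t)
            + ℓ₂ t (V₂ t (M.g₂.covDerivAlong γ₂ U₂ t)) - q t (U₂ t) • V t (G t) = 0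
        ∧ ℓ₁ t (T₁ t (U₁ t) (U₁ t)) + ℓ₂ t (T₂ t (U₂ t) (U₂ t)) - q t (U₂ t) • H t (G t) = 0))
    -- (ii) horizontal velocity
    ∧ ((∀ t ∈ J, γ' t ∈ horizontal (𝓘(ℝ, F₁).prod 𝓘(ℝ, F₂)) M.metric φ (γ t)) →
      (IsGeodesicOn M.metric γ J ↔ ∀ t ∈ J,
        ℓ₁ t (A₁ t (Y₁ t) (Y₁ t)) + ℓ₂ t (A₂ t (Y₂ t) (Y₂ t)) - q t (Y₂ t) • V t (G t) = 0
        ∧ ℓ₁ t (H₁ t (M.g₁.covDerivAlong γ₁ Y₁ t)) + (2 * df t (Y₁ t)) • ℓ₂ t (Y₂ t)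
            + ℓ₂ t (H₂ t (M.g₂.covDerivAlong γ₂ Y₂ t)) - q t (Y₂ t) • H t (G t) = 0))
    -- (iii) arbitrary velocity; the derivatives of `Uᵢ` and `Yᵢ` are taken along `γᵢ`, so that
    -- `𝒱ᵢ ∇_{γ̇ᵢ} Uᵢ` is `𝒱ᵢ ∇_{Uᵢ} Uᵢ + 𝒱ᵢ ∇_{Yᵢ} Uᵢ`, and similarly for `ℋᵢ ∇_{γ̇ᵢ} Yᵢ`
    ∧ (IsGeodesicOn M.metric γ J ↔ ∀ t ∈ J,
        ℓ₁ t (V₁ t (M.g₁.covDerivAlong γ₁ U₁ t)) + ℓ₁ t (T₁ t (U₁ t) (Y₁ t))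
            + ℓ₁ t (A₁ t (Y₁ t) (Y₁ t))
            + (2 * df t (U₁ t)) • ℓ₂ t (U₂ t) + (2 * df t (Y₁ t)) • ℓ₂ t (U₂ t)
            - q t (U₂ t) • V t (G t) - q t (Y₂ t) • V t (G t)
            + ℓ₂ t (V₂ t (M.g₂.covDerivAlong γ₂ U₂ t)) + ℓ₂ t (T₂ t (U₂ t) (Y₂ t))
            + ℓ₂ t (A₂ t (Y₂ t) (Y₂ t)) = 0
        ∧ ℓ₁ t (T₁ t (U₁ t) (U₁ t)) + ℓ₂ t (T₂ t (U₂ t) (U₂ t))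
            + ℓ₁ t (A₁ t (Y₁ t) (U₁ t)) + ℓ₂ t (A₂ t (Y₂ t) (U₂ t))
            + ℓ₁ t (H₁ t (M.g₁.covDerivAlong γ₁ Y₁ t)) + ℓ₂ t (H₂ t (M.g₂.covDerivAlong γ₂ Y₂ t))
            + (2 * df t (U₁ t)) • ℓ₂ t (Y₂ t) + (2 * df t (Y₁ t)) • ℓ₂ t (Y₂ t)
            - q t (U₂ t) • H t (G t) - q t (Y₂ t) • H t (G t) = 0)
    -- (iii), term by term, for vector fields that extend `Uᵢ` and `Yᵢ` near the points of `γᵢ`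
    ∧ ∀ (U₁' Y₁' : ℝ → ∀ x : M₁, TangentSpace 𝓘(ℝ, E₁) x)
        (U₂' Y₂' : ℝ → ∀ x : M₂, TangentSpace 𝓘(ℝ, E₂) x),
      (∀ t ∈ J, IsLocalExtensionAt 𝓘(ℝ, E₁) γ₁ U₁ t (U₁' t)
        ∧ IsLocalExtensionAt 𝓘(ℝ, E₁) γ₁ Y₁ t (Y₁' t)
        ∧ IsLocalExtensionAt 𝓘(ℝ, E₂) γ₂ U₂ t (U₂' t)
        ∧ IsLocalExtensionAt 𝓘(ℝ, E₂) γ₂ Y₂ t (Y₂' t)) →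
      (IsGeodesicOn M.metric γ J ↔ ∀ t ∈ J,
        ℓ₁ t (V₁ t (M.g₁.nabla (U₁' t) (γ₁ t) (U₁ t))) + ℓ₁ t (T₁ t (U₁ t) (Y₁ t))
            + ℓ₁ t (V₁ t (M.g₁.nabla (U₁' t) (γ₁ t) (Y₁ t))) + ℓ₁ t (A₁ t (Y₁ t) (Y₁ t))
            + (2 * df t (U₁ t)) • ℓ₂ t (U₂ t) + (2 * df t (Y₁ t)) • ℓ₂ t (U₂ t)
            - q t (U₂ t) • V t (G t) - q t (Y₂ t) • V t (G t)
            + ℓ₂ t (V₂ t (M.g₂.nabla (U₂' t) (γ₂ t) (U₂ t))) + ℓ₂ t (T₂ t (U₂ t) (Y₂ t))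
            + ℓ₂ t (A₂ t (Y₂ t) (Y₂ t)) + ℓ₂ t (V₂ t (M.g₂.nabla (U₂' t) (γ₂ t) (Y₂ t))) = 0
        ∧ ℓ₁ t (T₁ t (U₁ t) (U₁ t)) + ℓ₂ t (T₂ t (U₂ t) (U₂ t))
            + ℓ₁ t (H₁ t (M.g₁.nabla (Y₁' t) (γ₁ t) (U₁ t)))
            + ℓ₂ t (H₂ t (M.g₂.nabla (Y₂' t) (γ₂ t) (U₂ t)))
            + ℓ₁ t (A₁ t (Y₁ t) (U₁ t)) + ℓ₂ t (A₂ t (Y₂ t) (U₂ t))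
            + ℓ₁ t (H₁ t (M.g₁.nabla (Y₁' t) (γ₁ t) (Y₁ t)))
            + ℓ₂ t (H₂ t (M.g₂.nabla (Y₂' t) (γ₂ t) (Y₂ t)))
            + (2 * df t (U₁ t)) • ℓ₂ t (Y₂ t) + (2 * df t (Y₁ t)) • ℓ₂ t (Y₂ t)
            - q t (U₂ t) • H t (G t) - q t (Y₂ t) • H t (G t) = 0) := by
  intro γ γ' V₁ H₁ V₂ H₂ V H U₁ Y₁ U₂ Y₂ T₁ A₁ T₂ A₂ ℓ₁ ℓ₂ df q G
  have hs : ∀ t ∈ J, ContMDiffAt 𝓘(ℝ, ℝ) (𝓘(ℝ, E₁).prod 𝓘(ℝ, E₂)) ∞ γ t := fun t ht =>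
    hγ.1.contMDiffAt (hJ.mem_nhds ht)
  have h₁ : ∀ t ∈ J, ContMDiffAt 𝓘(ℝ, ℝ) 𝓘(ℝ, E₁) ∞ γ₁ t := fun t ht =>
    contMDiffAt_fst.comp t (hs t ht)
  have h₂ : ∀ t ∈ J, ContMDiffAt 𝓘(ℝ, ℝ) 𝓘(ℝ, E₂) ∞ γ₂ t := fun t ht =>
    contMDiffAt_snd.comp t (hs t ht)
  have hd₁ := fun t ht => (h₁ t ht).mdifferentiableAt (by simp)
  have hd₂ := fun t ht => (h₂ t ht).mdifferentiableAt (by simp)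
  have key : IsGeodesicOn M.metric γ J ↔ ∀ t ∈ J,
        ℓ₁ t (V₁ t (M.g₁.covDerivAlong γ₁ U₁ t)) + ℓ₁ t (T₁ t (U₁ t) (Y₁ t))
            + ℓ₁ t (A₁ t (Y₁ t) (Y₁ t))
            + (2 * df t (U₁ t)) • ℓ₂ t (U₂ t) + (2 * df t (Y₁ t)) • ℓ₂ t (U₂ t)
            - q t (U₂ t) • V t (G t) - q t (Y₂ t) • V t (G t)
            + ℓ₂ t (V₂ t (M.g₂.covDerivAlong γ₂ U₂ t)) + ℓ₂ t (T₂ t (U₂ t) (Y₂ t))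
            + ℓ₂ t (A₂ t (Y₂ t) (Y₂ t)) = 0
        ∧ ℓ₁ t (T₁ t (U₁ t) (U₁ t)) + ℓ₂ t (T₂ t (U₂ t) (U₂ t))
            + ℓ₁ t (A₁ t (Y₁ t) (U₁ t)) + ℓ₂ t (A₂ t (Y₂ t) (U₂ t))
            + ℓ₁ t (H₁ t (M.g₁.covDerivAlong γ₁ Y₁ t)) + ℓ₂ t (H₂ t (M.g₂.covDerivAlong γ₂ Y₂ t))
            + (2 * df t (U₁ t)) • ℓ₂ t (Y₂ t) + (2 * df t (Y₁ t)) • ℓ₂ t (Y₂ t)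
            - q t (U₂ t) • H t (G t) - q t (Y₂ t) • H t (G t) = 0 := by
    refine forall₂_congr fun t ht => ?_
    rw [← vertProj_eq_zero_and_horProj_eq_zero_iff (I' := 𝓘(ℝ, F₁).prod 𝓘(ℝ, F₂)) (φ := φ)]
    exact and_congr (Eq.congr (hφ.vertProj_acceleration (h₁ t ht) (h₂ t ht)) rfl)
      (Eq.congr (hφ.horProj_acceleration (h₁ t ht) (h₂ t ht)) rfl)
  refine ⟨fun hv => ?_, fun hh => ?_, key, fun U₁' Y₁' U₂' Y₂' hext => ?_⟩
  -- Vertical velocity: the `Yᵢ` vanish on the open set `J`, hence so do their derivatives.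
  · have hY : ∀ t ∈ J, Y₁ t = 0 ∧ Y₂ t = 0 := fun t ht => by
      obtain ⟨e₁, e₂⟩ := hφ.mem_vertical.1 (hv t ht)
      rw [dfst_velocity (hd₁ t ht) (hd₂ t ht)] at e₁
      rw [dsnd_velocity (hd₁ t ht) (hd₂ t ht)] at e₂
      exact ⟨horProj_of_mem_vertical e₁, horProj_of_mem_vertical e₂⟩
    have hn : ∀ t ∈ J, ∀ᶠ s in 𝓝 t, s ∈ J := fun t ht => hJ.mem_nhds ht
    rw [key]
    refine forall₂_congr fun t ht => ?_
    have c₁ : M.g₁.covDerivAlong γ₁ Y₁ t = 0 :=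
      M.g₁.covDerivAlong_eq_zero ((hn t ht).mono fun s hs => (hY s hs).1)
    have c₂ : M.g₂.covDerivAlong γ₂ Y₂ t = 0 :=
      M.g₂.covDerivAlong_eq_zero ((hn t ht).mono fun s hs => (hY s hs).2)
    have d0 : df t 0 = 0 := by simp only [df, map_zero, zero_div]
    have q0 : q t 0 = 0 := by simp only [q, map_zero]
    have a₁ : ∀ v, A₁ t 0 v = 0 := oneillA_zero_left _
    have a₂ : ∀ v, A₂ t 0 v = 0 := oneillA_zero_left _
    have t₁ : ∀ v, T₁ t v 0 = 0 := oneillT_zero_right _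
    have t₂ : ∀ v, T₂ t v 0 = 0 := oneillT_zero_right _
    rw [(hY t ht).1, (hY t ht).2, c₁, c₂, d0, q0, a₁, a₁, a₂, a₂, t₁, t₂]
    simp only [map_zero, mul_zero, zero_smul, smul_zero, add_zero, sub_zero]
    refine and_congr (Eq.congr ?_ rfl) Iff.rfl
    abel
  -- Horizontal velocity: the `Uᵢ` vanish on the open set `J`, hence so do their derivatives.
  · have hU : ∀ t ∈ J, U₁ t = 0 ∧ U₂ t = 0 := fun t ht => by
      have e := vertProj_of_mem_horizontal (hh t ht)
      have e₁ := hφ.dfst_vertProj (γ t) (γ' t)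
      have e₂ := hφ.dsnd_vertProj (γ t) (γ' t)
      rw [e, map_zero, dfst_velocity (hd₁ t ht) (hd₂ t ht)] at e₁
      rw [e, map_zero, dsnd_velocity (hd₁ t ht) (hd₂ t ht)] at e₂
      exact ⟨e₁.symm, e₂.symm⟩
    have hn : ∀ t ∈ J, ∀ᶠ s in 𝓝 t, s ∈ J := fun t ht => hJ.mem_nhds ht
    rw [key]
    refine forall₂_congr fun t ht => ?_
    have c₁ : M.g₁.covDerivAlong γ₁ U₁ t = 0 :=
      M.g₁.covDerivAlong_eq_zero ((hn t ht).mono fun s hs => (hU s hs).1)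
    have c₂ : M.g₂.covDerivAlong γ₂ U₂ t = 0 :=
      M.g₂.covDerivAlong_eq_zero ((hn t ht).mono fun s hs => (hU s hs).2)
    have d0 : df t 0 = 0 := by simp only [df, map_zero, zero_div]
    have q0 : q t 0 = 0 := by simp only [q, map_zero]
    have a₁ : ∀ v, A₁ t v 0 = 0 := oneillA_zero_right _
    have a₂ : ∀ v, A₂ t v 0 = 0 := oneillA_zero_right _
    have t₁ : ∀ v, T₁ t 0 v = 0 := oneillT_zero_left _
    have t₂ : ∀ v, T₂ t 0 v = 0 := oneillT_zero_left _
    rw [(hU t ht).1, (hU t ht).2, c₁, c₂, d0, q0, a₁, a₂, t₁, t₁, t₂, t₂]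
    simp only [map_zero, mul_zero, zero_smul, smul_zero, add_zero, zero_add, sub_zero]
    refine and_congr (Eq.congr ?_ rfl) (Eq.congr ?_ rfl)
    · abel
    · abel
  -- Local extensions: `∇_γ̇ᵢ` along the curve is `∇_Uᵢ + ∇_Yᵢ` applied to the extension.
  · rw [key]
    refine forall₂_congr fun t ht => ?_
    obtain ⟨x₁, x₂, x₃, x₄⟩ := hext t ht
    have s₁ : velocity 𝓘(ℝ, E₁) γ₁ t = U₁ t + Y₁ t :=
      (vertProj_add_horProj M.g₁ φ₁ (γ₁ t) _).symm
    have s₂ : velocity 𝓘(ℝ, E₂) γ₂ t = U₂ t + Y₂ t :=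
      (vertProj_add_horProj M.g₂ φ₂ (γ₂ t) _).symm
    rw [← M.g₁.nabla_velocity_of_extension U₁ (hd₁ t ht) x₁,
      ← M.g₁.nabla_velocity_of_extension Y₁ (hd₁ t ht) x₂,
      ← M.g₂.nabla_velocity_of_extension U₂ (hd₂ t ht) x₃,
      ← M.g₂.nabla_velocity_of_extension Y₂ (hd₂ t ht) x₄, s₁, s₂]
    simp only [Metric.nabla_add, map_add]
    refine and_congr (Eq.congr ?_ rfl) (Eq.congr ?_ rfl)
    · abel
    · abel
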